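/- Let $n\ge 1$ and let $w_1,\dots,w_n,z_1,\dots,z_n$ be $2n$ distinct points (the basepoints) of the sphere $S^2=\mathbb C\cup\{\infty\}$, with the complex coordinate chosen so that $z_n=\infty$; put $B=\{w_1,\dots,w_n,z_1,\dots,z_{n-1}\}\subset\mathbb C$, so that $S^2\setminus\{\mathbf w,\mathbf z\}=\mathbb C\setminus B$. Let $\Sigma(S^2)$ be the double branched cover of $S^2$ over the basepoints; away from the branch points it is the curve $$\Sigma(S^2)\setminus\{\mathbf w,\mathbf z\}=\Big\{(x,y)\in\mathbb C^2 : x\notin B,\ y^2=\prod_{b\in B}(x-b)\Big\},$$ with projection $(x,y)\mapsto x$, covering involution $\tau(x,y)=(x,-y)$, and the complex structure pulled back from $\mathbb C\setminus B$. For a Riemann surface $X$, let $\mathrm{Sym}^m(X)=X^m/S_m$ carry its standard structure of an $m$-dimensional complex manifold, whose charts send $x_1\cdots x_m$ to the elementary symmetric functions of $g(x_1),\dots,g(x_m)$, for $g$ a biholomorphism from an open subset of $X$ onto an open subset of $\mathbb C$. Put $M=\mathrm{Sym}^{2n-2}(\Sigma(S^2)\setminus\{\mathbf w,\mathbf z\})$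 and let $$i\colon \mathrm{Sym}^{n-1}(S^2\setminus\{\mathbf w,\mathbf z\})\hookrightarrow M,\qquad x_1\cdots x_{n-1}\mapsto \tilde x_1\tau(\tilde x_1)\cdots\tilde x_{n-1}\tau(\tilde x_{n-1}),$$ where $\tilde x$ is either preimage of $x$, be the resulting holomorphic embedding, with image $M^{\mathrm{inv}}$. Let $N(M^{\mathrm{inv}})=TM|_{M^{\mathrm{inv}}}/TM^{\mathrm{inv}}$ be the normal bundle of $M^{\mathrm{inv}}$ in $M$, and let $\Upsilon(M^{\mathrm{inv}})$ be its pullback along the projection $M^{\mathrm{inv}}\times[0,1]\to M^{\mathrm{inv}}$. Then $N(M^{\mathrm{inv}})$ and $\Upsilon(M^{\mathrm{inv}})$ are trivial complex vector bundles (of rank $n-1$). -/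

import Mathlib

noncomputable section

open scoped Manifold ContDiff Topology


namespace SymProd

open Polynomial in
/-- The monic polynomial whose roots have elementary symmetric functions `a`. -/
def monicPoly {m : ℕ} (a : Fin m → ℂ) : ℂ[X] :=
  X ^ m + ∑ k : Fin m, C ((-1) ^ (k.1 + 1) * a k) * X ^ (m - (k.1 + 1))

/-- The unordered tuple of the entries of an ordered tuple. -/
def ofTuple {X : Type*} {m : ℕ} (x : Fin m → X) : Sym X m :=
  ⟨Finset.univ.val.map x, by simp⟩

/-- The quotient topology on `Sym X m = X ^ m / S_m`. -/
instance instTopologicalSpaceSym {X : Type*} [TopologicalSpace X] {m : ℕ} :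
    TopologicalSpace (Sym X m) :=
  TopologicalSpace.coinduced ofTuple inferInstance

theorem ofTuple_surjective {X : Type*} {m : ℕ} :
    Function.Surjective (ofTuple : (Fin m → X) → Sym X m) := by
  rintro ⟨s, hs⟩
  induction s using Quotient.inductionOn with
  | h l =>
    have hl : l.length = m := by simpa using hs
    subst hl
    refine ⟨l.get, Subtype.ext ?_⟩
    simp [ofTuple, Fin.univ_def, Multiset.map_coe]

theorem isQuotientMap_ofTuple {X : Type*} [TopologicalSpace X] {m : ℕ} :
    Topology.IsQuotientMap (ofTuple : (Fin m → X) → Sym X m) :=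
  ⟨⟨rfl⟩, ofTuple_surjective⟩

theorem mem_ofTuple {X : Type*} {m : ℕ} {x : Fin m → X} {p : X} :
    p ∈ ofTuple x ↔ ∃ k, x k = p := by
  change p ∈ Multiset.map x Finset.univ.val ↔ _
  simp

theorem map_ofTuple {X Y : Type*} {m : ℕ} (f : X → Y) (x : Fin m → X) :
    Sym.map f (ofTuple x) = ofTuple (f ∘ x) := by
  refine Subtype.ext ?_
  exact Multiset.map_map f x Finset.univ.val

/-- The elementary symmetric functions `(σ₁, …, σ_m)` of `m` unordered complex numbers. -/
def esymmFun {m : ℕ} (s : Sym ℂ m) : Fin m → ℂ := fun k => s.1.esymm (k.1 + 1)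

open Polynomial in
theorem monicPoly_esymmFun {m : ℕ} (s : Sym ℂ m) :
    monicPoly (esymmFun s) = (s.1.map fun r => X - C r).prod := by
  obtain ⟨s, hs⟩ := s
  rw [Multiset.prod_X_sub_X_eq_sum_esymm, Finset.sum_range_succ']
  subst hs
  simp only [monicPoly, esymmFun, Finset.sum_range]
  rw [add_comm]
  simp [mul_assoc, Multiset.esymm]

open Polynomial in
theorem natDegree_sum_lt {m : ℕ} (a : Fin m → ℂ) :
    (∑ k : Fin m, C ((-1) ^ (k.1 + 1) * a k) * X ^ (m - (k.1 + 1)) : ℂ[X]).degree < (m : ℕ) := by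
  refine (Polynomial.degree_sum_le _ _).trans_lt ?_
  rw [Finset.sup_lt_iff (by exact WithBot.bot_lt_coe m)]
  intro k _
  refine (degree_C_mul_X_pow_le _ _).trans_lt ?_
  exact_mod_cast (by omega : m - (k.1 + 1) < m)

theorem monicPoly_monic {m : ℕ} (a : Fin m → ℂ) : (monicPoly a).Monic :=
  Polynomial.monic_X_pow_add (natDegree_sum_lt a)

theorem monicPoly_natDegree {m : ℕ} (a : Fin m → ℂ) : (monicPoly a).natDegree = m := by
  refine Polynomial.natDegree_eq_of_degree_eq_some ?_
  unfold monicPoly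
  rw [Polynomial.degree_add_eq_left_of_degree_lt] <;> simp only [Polynomial.degree_X_pow]
  exact natDegree_sum_lt a

theorem monicPoly_coeff {m : ℕ} (a : Fin m → ℂ) (k : Fin m) :
    (monicPoly a).coeff (m - (k.1 + 1)) = (-1) ^ (k.1 + 1) * a k := by
  have hk := k.2
  simp only [monicPoly, Polynomial.coeff_add, Polynomial.finsetSum_coeff,
    Polynomial.coeff_C_mul, Polynomial.coeff_X_pow]
  rw [if_neg (by omega), zero_add, Finset.sum_eq_single k]
  · simp
  · intro j _ hj
    have : j.1 ≠ k.1 := fun h => hj (Fin.ext h)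
    have := j.2
    rw [if_neg (by omega), mul_zero]
  · simp

theorem monicPoly_injective {m : ℕ} : Function.Injective (monicPoly : (Fin m → ℂ) → _) := by
  intro a b h
  ext k
  have := monicPoly_coeff a k
  rw [h, monicPoly_coeff] at this
  simpa using this.symm

theorem esymmFun_injective {m : ℕ} : Function.Injective (esymmFun (m := m)) := by
  intro s t h
  have := monicPoly_esymmFun s
  rw [h, monicPoly_esymmFun t] at this
  have h2 := congrArg Polynomial.roots this
  rw [Polynomial.roots_multiset_prod_X_sub_C, Polynomial.roots_multiset_prod_X_sub_C] at h2
  exact Subtype.ext h2.symm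

theorem esymmFun_surjective {m : ℕ} : Function.Surjective (esymmFun (m := m)) := by
  intro a
  have hs := IsAlgClosed.splits (monicPoly a)
  have hc : Multiset.card (monicPoly a).roots = m := by
    rw [← hs.natDegree_eq_card_roots, monicPoly_natDegree]
  refine ⟨⟨(monicPoly a).roots, hc⟩, monicPoly_injective ?_⟩
  refine (monicPoly_esymmFun _).trans ?_
  exact (hs.eq_prod_roots_of_monic (monicPoly_monic a)).symm

theorem continuous_esymmFun {m : ℕ} : Continuous (esymmFun (m := m)) := by
  rw [isQuotientMap_ofTuple.continuous_iff]
  refine continuous_pi fun k => ?_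
  change Continuous fun x : Fin m → ℂ => (Finset.univ.val.map x).esymm (k.1 + 1)
  simp only [Finset.esymm_map_val]
  fun_prop

theorem eval_monicPoly_esymmFun {m : ℕ} (x : Fin m → ℂ) (z : ℂ) :
    (monicPoly (esymmFun (ofTuple x))).eval z = ∏ k, (z - x k) := by
  rw [monicPoly_esymmFun, Polynomial.eval_multiset_prod]
  change ((((Finset.univ.val.map x).map fun r => Polynomial.X - Polynomial.C r)).map
    (Polynomial.eval z)).prod = _
  rw [Multiset.map_map, Multiset.map_map]
  exact congrArg Multiset.prod (Multiset.map_congr rfl fun k _ => by simp)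

theorem norm_le_of_esymmFun {m : ℕ} (x : Fin m → ℂ) :
    ‖x‖ ≤ ‖esymmFun (ofTuple x)‖ + 1 := by
  rw [pi_norm_le_iff_of_nonneg (by positivity)]
  intro k
  set a := esymmFun (ofTuple x)
  have hroot : (monicPoly a).IsRoot (x k) := by
    rw [Polynomial.IsRoot, eval_monicPoly_esymmFun]
    exact Finset.prod_eq_zero (Finset.mem_univ k) (sub_self _)
  have h := hroot.norm_lt_cauchyBound (monicPoly_monic a).ne_zero
  have h2 : (monicPoly a).cauchyBound ≤ ‖a‖₊ + 1 := by
    unfold Polynomial.cauchyBound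
    rw [(monicPoly_monic a).leadingCoeff, nnnorm_one, div_one, monicPoly_natDegree]
    gcongr
    refine Finset.sup_le fun j hj => ?_
    have hj : j < m := by simpa using hj
    have := monicPoly_coeff a ⟨m - (j + 1), by omega⟩
    simp only at this
    rw [show m - (m - (j + 1) + 1) = j by omega] at this
    rw [this]
    simpa using nnnorm_le_pi_nnnorm a _
  have h3 : ‖x k‖₊ ≤ ‖a‖₊ + 1 := h.le.trans h2
  exact_mod_cast h3

theorem isClosedMap_esymmFun {m : ℕ} : IsClosedMap (esymmFun (m := m)) := by
  have hp : IsProperMap fun x : Fin m → ℂ => esymmFun (ofTuple x) := by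
    rw [isProperMap_iff_tendsto_cocompact]
    refine ⟨continuous_esymmFun.comp isQuotientMap_ofTuple.continuous, ?_⟩
    rw [← Metric.cobounded_eq_cocompact,
      ← tendsto_norm_atTop_iff_cobounded]
    refine Filter.tendsto_atTop_mono (f := fun x => ‖x‖ - 1)
      (fun x => by linarith [norm_le_of_esymmFun x]) ?_
    exact Filter.tendsto_atTop_add_const_right _ _ tendsto_norm_cobounded_atTop
  intro C hC
  have := hp.isClosedMap _ (hC.preimage isQuotientMap_ofTuple.continuous)
  rw [show (fun x : Fin m → ℂ => esymmFun (ofTuple x)) = esymmFun ∘ ofTuple from rfl,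
    Set.image_comp, Set.image_preimage_eq _ ofTuple_surjective] at this
  exact this

/-- The homeomorphism `Sym^m(ℂ) ≃ ℂ^m` given by the elementary symmetric functions. -/
def esymmHomeo (m : ℕ) : Sym ℂ m ≃ₜ (Fin m → ℂ) :=
  (Equiv.ofBijective esymmFun ⟨esymmFun_injective, esymmFun_surjective⟩).toHomeomorphOfContinuousClosed
    continuous_esymmFun isClosedMap_esymmFun

theorem esymmHomeo_apply {m : ℕ} (s : Sym ℂ m) : esymmHomeo m s = esymmFun s := rfl

theorem isOpen_setOf_forall_mem {X : Type*} [TopologicalSpace X] {m : ℕ} {U : Set X}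
    (hU : IsOpen U) : IsOpen {s : Sym X m | ∀ p ∈ s, p ∈ U} := by
  rw [← isQuotientMap_ofTuple.isOpen_preimage]
  have : ofTuple ⁻¹' {s : Sym X m | ∀ p ∈ s, p ∈ U} = Set.pi Set.univ fun _ => U := by
    ext x
    simp [mem_ofTuple]
  rw [this]
  exact isOpen_set_pi Set.finite_univ fun _ _ => hU

theorem continuousOn_map {X Y : Type*} [TopologicalSpace X] [TopologicalSpace Y] {m : ℕ}
    {U : Set X} (hU : IsOpen U) {f : X → Y} (hf : ContinuousOn f U) :
    ContinuousOn (Sym.map f : Sym X m → Sym Y m) {s | ∀ p ∈ s, p ∈ U} := by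
  rw [isQuotientMap_ofTuple.continuousOn_isOpen_iff (isOpen_setOf_forall_mem hU)]
  have : (Sym.map f : Sym X m → Sym Y m) ∘ ofTuple = ofTuple ∘ fun x => f ∘ x :=
    funext fun x => map_ofTuple f x
  rw [this]
  refine isQuotientMap_ofTuple.continuous.comp_continuousOn ?_
  refine continuousOn_pi.2 fun k => ?_
  refine hf.comp (continuous_apply k).continuousOn fun x hx => ?_
  exact hx _ (mem_ofTuple.2 ⟨k, rfl⟩)

/-- The chart `Sym^m(g)` of `Sym^m(X)` induced by a chart `g` of `X`: it is defined on the unordered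
tuples of points of the domain of `g`, and sends `x₁ ⋯ x_m` to the elementary symmetric functions
of `g x₁, …, g x_m`. -/
def symChart {X : Type*} [TopologicalSpace X] (m : ℕ) (g : OpenPartialHomeomorph X ℂ) :
    OpenPartialHomeomorph (Sym X m) (Fin m → ℂ) :=
  OpenPartialHomeomorph.transHomeomorph
    { toFun := Sym.map g
      invFun := Sym.map g.symm
      source := {s | ∀ p ∈ s, p ∈ g.source}
      target := {s | ∀ p ∈ s, p ∈ g.target}
      map_source' := by
        intro s hs p hp
        obtain ⟨q, hq, rfl⟩ := Sym.mem_map.1 hp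
        exact g.map_source (hs q hq)
      map_target' := by
        intro s hs p hp
        obtain ⟨q, hq, rfl⟩ := Sym.mem_map.1 hp
        exact g.map_target (hs q hq)
      left_inv' := by
        intro s hs
        rw [Sym.map_map]
        exact (Sym.map_congr fun p hp => g.left_inv (hs p hp)).trans (Sym.map_id' s)
      right_inv' := by
        intro s hs
        rw [Sym.map_map]
        exact (Sym.map_congr fun p hp => g.right_inv (hs p hp)).trans (Sym.map_id' s)
      open_source := isOpen_setOf_forall_mem g.open_source
      open_target := isOpen_setOf_forall_mem g.open_target
      continuousOn_toFun := continuousOn_map g.open_source g.continuousOn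
      continuousOn_invFun := continuousOn_map g.open_target g.continuousOn_symm }
    (esymmHomeo m)


section Charts

variable {X : Type*} [TopologicalSpace X] [ChartedSpace ℂ X]

/-- A holomorphic chart of a Riemann surface: a biholomorphism from an open subset (not
necessarily connected) onto an open subset of `ℂ`. -/
def IsHolChart (g : OpenPartialHomeomorph X ℂ) : Prop :=
  ContMDiffOn 𝓘(ℂ) 𝓘(ℂ) ω g g.source ∧ ContMDiffOn 𝓘(ℂ) 𝓘(ℂ) ω g.symm g.target

theorem isHolChart_chartAt [IsManifold 𝓘(ℂ) ω X] (p : X) : IsHolChart (chartAt ℂ p) :=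
  ⟨contMDiffOn_chart, contMDiffOn_chart_symm⟩

theorem IsHolChart.restr {g : OpenPartialHomeomorph X ℂ} (hg : IsHolChart g) (U : Set X) :
    IsHolChart (g.restr U) := by
  refine ⟨hg.1.mono ?_, hg.2.mono ?_⟩
  · exact Set.inter_subset_left
  · simp

theorem IsHolChart.translate {g : OpenPartialHomeomorph X ℂ} (hg : IsHolChart g) (c : ℂ) :
    IsHolChart (g.transHomeomorph (Homeomorph.addRight c)) := by
  refine ⟨?_, ?_⟩
  · have h : ContMDiff 𝓘(ℂ) 𝓘(ℂ) ω (fun z : ℂ => z + c) :=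
      (contDiff_id.add contDiff_const).contMDiff
    exact h.comp_contMDiffOn hg.1
  · have h : ContMDiff 𝓘(ℂ) 𝓘(ℂ) ω (fun z : ℂ => z + -c) :=
      (contDiff_id.add contDiff_const).contMDiff
    exact hg.2.comp h.contMDiffOn fun z hz => hz

open Classical in
theorem IsHolChart.disjointUnion {g h : OpenPartialHomeomorph X ℂ} (hg : IsHolChart g)
    (hh : IsHolChart h) (hs : Disjoint g.source h.source) (ht : Disjoint g.target h.target) :
    IsHolChart (g.disjointUnion h hs ht) := by
  constructor
  · refine ContMDiffOn.union_of_isOpen (hg.1.congr fun x hx => ?_) (hh.1.congr fun x hx => ?_)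
      g.open_source h.open_source
    · change g.source.piecewise g h x = g x
      simp [hx]
    · change g.source.piecewise g h x = h x
      have := hs.notMem_of_mem_right hx
      simp [this]
  · refine ContMDiffOn.union_of_isOpen (hg.2.congr fun x hx => ?_) (hh.2.congr fun x hx => ?_)
      g.open_target h.open_target
    · change g.target.piecewise g.symm h.symm x = g.symm x
      simp [hx]
    · change g.target.piecewise g.symm h.symm x = h.symm x
      have := ht.notMem_of_mem_right hx
      simp [this]

/-- Any finite set of points of a Riemann surface lies in the domain of one holomorphic chart. -/
theorem exists_isHolChart [IsManifold 𝓘(ℂ) ω X] [T2Space X] [Nonempty X] (s : Finset X) :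
    ∃ g : OpenPartialHomeomorph X ℂ, IsHolChart g ∧ ∀ p ∈ s, p ∈ g.source := by
  classical
  induction s using Finset.induction_on with
  | empty =>
    obtain ⟨p⟩ := ‹Nonempty X›
    exact ⟨chartAt ℂ p, isHolChart_chartAt p, by simp⟩
  | insert q s hq ih =>
    obtain ⟨g, hg, hgs⟩ := ih
    obtain ⟨c, hc⟩ : ∃ c : ℂ, chartAt ℂ q q + c ∉ (s.image g : Set ℂ) := by
      obtain ⟨d, hd⟩ := (s.image g).exists_notMem
      exact ⟨d - chartAt ℂ q q, by simpa using hd⟩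
    set h := (chartAt ℂ q).transHomeomorph (Homeomorph.addRight c) with hh
    have hhol : IsHolChart h := (isHolChart_chartAt q).translate c
    have hqh : q ∈ h.source := mem_chart_source ℂ q
    have hq' : h q ∉ (s.image g : Set ℂ) := hc
    obtain ⟨U₁, U₂, hU₁, hU₂, hsU, hqU, hU⟩ :=
      (s.finite_toSet.isCompact).separation_of_notMem hq
    obtain ⟨V₁, V₂, hV₁, hV₂, hsV, hqV, hV⟩ :=
      ((s.image g).finite_toSet.isCompact).separation_of_notMem hq'
    have hA : IsOpen (g.source ∩ g ⁻¹' V₁ ∩ U₁) := (g.isOpen_inter_preimage hV₁).inter hU₁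
    have hB : IsOpen (h.source ∩ h ⁻¹' V₂ ∩ U₂) := (h.isOpen_inter_preimage hV₂).inter hU₂
    have hgA := hg.restr (g.source ∩ g ⁻¹' V₁ ∩ U₁)
    have hhB := hhol.restr (h.source ∩ h ⁻¹' V₂ ∩ U₂)
    have hsA : (g.restr (g.source ∩ g ⁻¹' V₁ ∩ U₁)).source ⊆ g.source ∩ g ⁻¹' V₁ ∩ U₁ := by
      rw [g.restr_source' _ hA]
      exact Set.inter_subset_right
    have hsB : (h.restr (h.source ∩ h ⁻¹' V₂ ∩ U₂)).source ⊆ h.source ∩ h ⁻¹' V₂ ∩ U₂ := by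
      rw [h.restr_source' _ hB]
      exact Set.inter_subset_right
    have hd1 : Disjoint (g.restr (g.source ∩ g ⁻¹' V₁ ∩ U₁)).source
        (h.restr (h.source ∩ h ⁻¹' V₂ ∩ U₂)).source :=
      hU.mono (hsA.trans Set.inter_subset_right) (hsB.trans Set.inter_subset_right)
    have hd2 : Disjoint (g.restr (g.source ∩ g ⁻¹' V₁ ∩ U₁)).target
        (h.restr (h.source ∩ h ⁻¹' V₂ ∩ U₂)).target := by
      refine hV.mono ?_ ?_
      · rw [← OpenPartialHomeomorph.image_source_eq_target]
        rintro _ ⟨x, hx, rfl⟩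
        exact (hsA hx).1.2
      · rw [← OpenPartialHomeomorph.image_source_eq_target]
        rintro _ ⟨x, hx, rfl⟩
        exact (hsB hx).1.2
    refine ⟨_, hgA.disjointUnion hhB hd1 hd2, fun p hp => ?_⟩
    rcases Finset.mem_insert.1 hp with rfl | hp
    · right
      rw [h.restr_source' _ hB]
      exact ⟨hqh, ⟨hqh, hqV⟩, hqU⟩
    · left
      rw [g.restr_source' _ hA]
      exact ⟨hgs p hp, ⟨hgs p hp, hsV (by simpa using ⟨p, hp, rfl⟩)⟩, hsU hp⟩

theorem exists_isHolChart_sym [IsManifold 𝓘(ℂ) ω X] [T2Space X] [Nonempty X] {m : ℕ} (s : Sym X m) :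
    ∃ g : OpenPartialHomeomorph X ℂ, IsHolChart g ∧ s ∈ (symChart m g).source := by
  classical
  obtain ⟨g, hg, hs⟩ := exists_isHolChart s.1.toFinset
  exact ⟨g, hg, fun p hp => hs p (Multiset.mem_toFinset.2 hp)⟩

/-- The charted space structure on `Sym^m(X)`: the atlas consists of the charts `Sym^m(g)` for all
holomorphic charts `g` of `X`. -/
instance instChartedSpaceSym [IsManifold 𝓘(ℂ) ω X] [T2Space X] [Nonempty X] {m : ℕ} :
    ChartedSpace (Fin m → ℂ) (Sym X m) where
  atlas := {e | ∃ g : OpenPartialHomeomorph X ℂ, IsHolChart g ∧ e = symChart m g}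
  chartAt s := symChart m (exists_isHolChart_sym s).choose
  mem_chart_source s := (exists_isHolChart_sym s).choose_spec.2
  chart_mem_atlas s := ⟨_, (exists_isHolChart_sym s).choose_spec.1, rfl⟩

end Charts

/-- Integration over a circle as a continuous linear functional. -/
theorem exists_circleIntegral_clm (c : ℂ) {R : ℝ} (hR : 0 ≤ R) :
    ∃ L : C(Metric.sphere c R, ℂ) →L[ℂ] ℂ, ∀ (h : C(Metric.sphere c R, ℂ)) (f : ℂ → ℂ),
      (∀ z : Metric.sphere c R, h z = f z) → L h = ∮ z in C(c, R), f z := by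
  let p : ℝ → Metric.sphere c R := fun θ => ⟨circleMap c R θ, circleMap_mem_sphere c hR θ⟩
  have hp : Continuous p := (continuous_circleMap c R).subtype_mk _
  have hcont : ∀ h : C(Metric.sphere c R, ℂ),
      Continuous fun θ => deriv (circleMap c R) θ * h (p θ) := fun h => by
    simp only [deriv_circleMap]
    have := continuous_circleMap 0 R
    have := h.continuous.comp hp
    fun_prop
  let T : C(Metric.sphere c R, ℂ) →ₗ[ℂ] ℂ :=
    { toFun := fun h => ∫ θ in (0 : ℝ)..2 * Real.pi, deriv (circleMap c R) θ * h (p θ)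
      map_add' := fun h k => by
        rw [← intervalIntegral.integral_add ((hcont h).intervalIntegrable _ _)
          ((hcont k).intervalIntegrable _ _)]
        simp [mul_add]
      map_smul' := fun a h => by
        simp only [ContinuousMap.coe_smul, Pi.smul_apply, smul_eq_mul, RingHom.id_apply]
        rw [← intervalIntegral.integral_const_mul]
        congr 1
        ext θ
        ring }
  refine ⟨T.mkContinuous (R * |2 * Real.pi - 0|) fun h => ?_, fun h f hf => ?_⟩
  · have := intervalIntegral.norm_integral_le_of_norm_le_const (a := 0) (b := 2 * Real.pi)
      (f := fun θ => deriv (circleMap c R) θ * h (p θ)) (C := R * ‖h‖) fun θ _ => by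
        rw [norm_mul]
        gcongr
        · simp [deriv_circleMap, abs_of_nonneg hR]
        · exact h.norm_coe_le_norm _
    refine this.trans (le_of_eq (by ring))
  · change (∫ θ in (0 : ℝ)..2 * Real.pi, deriv (circleMap c R) θ * h (p θ)) = _
    simp only [circleIntegral, smul_eq_mul]
    congr 1
    ext θ
    rw [hf]

theorem contDiff_linear_monicPoly {m : ℕ} {E : Type*} [NormedAddCommGroup E] [NormedSpace ℂ E]
    (T : Polynomial ℂ →ₗ[ℂ] E) : ContDiff ℂ ω fun a : Fin m → ℂ => T (monicPoly a) := by
  have : ∀ a : Fin m → ℂ, T (monicPoly a) = T (Polynomial.X ^ m) + ∑ k : Fin m,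
      a k • T ((-1 : ℂ) ^ (k.1 + 1) • Polynomial.X ^ (m - (k.1 + 1))) := by
    intro a
    simp only [monicPoly, map_add, map_sum, ← map_smul]
    congr 1
    refine Finset.sum_congr rfl fun k _ => ?_
    rw [smul_smul, Polynomial.smul_eq_C_mul, mul_comm (a k)]
  simp only [this]
  fun_prop

theorem contDiffAt_circleIntegral {m : ℕ} {c : ℂ} {R : ℝ} (hR : 0 ≤ R) {ψ : ℂ → ℂ}
    (hψ : ContinuousOn ψ (Metric.sphere c R)) {a₀ : Fin m → ℂ}
    (ha : ∀ z ∈ Metric.sphere c R, (monicPoly a₀).eval z ≠ 0) :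
    ContDiffAt ℂ ω (fun a : Fin m → ℂ => ∮ z in C(c, R),
      ψ z * ((monicPoly a).derivative.eval z / (monicPoly a).eval z)) a₀ := by
  obtain ⟨L, hL⟩ := exists_circleIntegral_clm c hR
  let K := Metric.sphere c R
  let ev : Polynomial ℂ →ₗ[ℂ] C(K, ℂ) := (Polynomial.toContinuousMapOnAlgHom K).toLinearMap
  let Ψ : C(K, ℂ) := ⟨K.domRestrict ψ, hψ.domRestrict⟩
  let A : (Fin m → ℂ) → C(K, ℂ) := fun a => ev (monicPoly a)
  let B : (Fin m → ℂ) → C(K, ℂ) := fun a => (ev ∘ₗ Polynomial.derivative) (monicPoly a)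
  have hA : ContDiff ℂ ω A := contDiff_linear_monicPoly _
  have hB : ContDiff ℂ ω B := contDiff_linear_monicPoly _
  have hu : IsUnit (A a₀) := by
    rw [ContinuousMap.isUnit_iff_forall_ne_zero]
    exact fun z => ha z z.2
  have hinv : ContDiffAt ℂ ω (fun a => Ring.inverse (A a)) a₀ := by
    obtain ⟨u, hu⟩ := hu
    have h1 : ContDiffAt ℂ ω Ring.inverse (A a₀) := hu ▸ contDiffAt_ringInverse ℂ u
    exact h1.comp a₀ hA.contDiffAt
  have hmain : ContDiffAt ℂ ω (fun a => L (Ψ * (B a * Ring.inverse (A a)))) a₀ :=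
    L.contDiff.contDiffAt.comp a₀ (contDiffAt_const.mul (hB.contDiffAt.mul hinv))
  refine hmain.congr_of_eventuallyEq ?_
  have hev : ∀ᶠ a in 𝓝 a₀, IsUnit (A a) :=
    hA.continuous.continuousAt.eventually (Units.isOpen.mem_nhds hu)
  filter_upwards [hev] with a hua
  refine (hL _ _ fun z => ?_).symm
  have h1 : Ring.inverse (A a) z = ((monicPoly a).eval (z : ℂ))⁻¹ := by
    have h2 := congrArg (fun f : C(K, ℂ) => f z) (Ring.mul_inverse_cancel _ hua)
    exact eq_inv_of_mul_eq_one_right h2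
  change ψ z * ((monicPoly a).derivative.eval (z : ℂ) * Ring.inverse (A a) z) = _
  rw [h1, div_eq_mul_inv]

/-- The residue computation for the logarithmic derivative of `∏ (z - x k)`. -/
theorem circleIntegral_logDeriv {m : ℕ} {c : ℂ} {R : ℝ} (hR : 0 < R) {ψ : ℂ → ℂ}
    (hψ : DifferentiableOn ℂ ψ (Metric.closedBall c R)) (x : Fin m → ℂ)
    (hx : ∀ k, x k ∉ Metric.sphere c R) :
    (∮ z in C(c, R), ψ z * ((monicPoly (esymmFun (ofTuple x))).derivative.eval z /
      (monicPoly (esymmFun (ofTuple x))).eval z)) =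
      2 * Real.pi * Complex.I * ∑ k, (Metric.ball c R).indicator ψ (x k) := by
  have hne : ∀ z ∈ Metric.sphere c R, ∀ k, z - x k ≠ 0 := fun z hz k h =>
    hx k (by rw [← sub_eq_zero.1 h]; exact hz)
  have h1 : ∀ z ∈ Metric.sphere c R, ψ z * ((monicPoly (esymmFun (ofTuple x))).derivative.eval z /
      (monicPoly (esymmFun (ofTuple x))).eval z) = ∑ k, (z - x k)⁻¹ • ψ z := by
    intro z hz
    have hd : (monicPoly (esymmFun (ofTuple x))).derivative.eval z =
        deriv (fun z => ∏ k, (z - x k)) z := by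
      rw [← Polynomial.deriv]
      congr 1
      ext w
      exact eval_monicPoly_esymmFun x w
    rw [hd, eval_monicPoly_esymmFun, ← logDeriv_apply, logDeriv_prod]
    · rw [Finset.mul_sum]
      refine Finset.sum_congr rfl fun k _ => ?_
      rw [logDeriv_apply]
      simp [mul_comm]
    · exact fun k _ => hne z hz k
    · intro k _
      fun_prop
  rw [circleIntegral.integral_congr hR.le h1, circleIntegral.integral_fun_sum, Finset.mul_sum]
  · refine Finset.sum_congr rfl fun k _ => ?_
    by_cases hk : x k ∈ Metric.ball c R
    · rw [Set.indicator_of_mem hk, hψ.circleIntegral_sub_inv_smul hk, smul_eq_mul]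
    · rw [Set.indicator_of_notMem hk, mul_zero]
      refine DiffContOnCl.circleIntegral_eq_zero hR.le ?_
      have : DifferentiableOn ℂ (fun z => (z - x k)⁻¹ • ψ z) (Metric.closedBall c R) := by
        refine DifferentiableOn.smul (DifferentiableOn.inv
          (differentiableOn_id.sub (differentiableOn_const _)) fun z hz h => ?_) hψ
        have hzk : z = x k := sub_eq_zero.1 h
        rw [hzk] at hz
        rw [← Metric.ball_union_sphere] at hz
        exact hz.elim hk (hx k)
      exact (this.mono Metric.closure_ball_subset_closedBall).diffContOnCl
  · intro k _
    refine ContinuousOn.circleIntegrable hR.le ?_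
    refine ContinuousOn.smul (ContinuousOn.inv₀ (by fun_prop) fun z hz => hne z hz k) ?_
    exact hψ.continuousOn.mono Metric.sphere_subset_closedBall

/-- For `ψ` holomorphic on `W`, the sum of `ψ` over `m` points of `W` is a holomorphic function
of the elementary symmetric functions of these points. -/
theorem contDiffOn_sum_map {m : ℕ} {W : Set ℂ} (hW : IsOpen W) {ψ : ℂ → ℂ}
    (hψ : DifferentiableOn ℂ ψ W) :
    ContDiffOn ℂ ω (fun a : Fin m → ℂ => (((esymmHomeo m).symm a).1.map ψ).sum)
      {a | ∀ r ∈ (esymmHomeo m).symm a, r ∈ W} := by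
  classical
  intro a₀ ha₀
  refine ContDiffAt.contDiffWithinAt ?_
  set S : Finset ℂ := ((esymmHomeo m).symm a₀).1.toFinset with hS
  have hSW : ∀ r ∈ S, r ∈ W := fun r hr => ha₀ r (Multiset.mem_toFinset.1 hr)
  -- a common radius
  obtain ⟨ε, hε, hεW, hεd⟩ : ∃ ε > 0, (∀ r ∈ S, Metric.closedBall r ε ⊆ W) ∧
      ∀ r ∈ S, ∀ t ∈ S, r ≠ t → 2 * ε < dist r t := by
    have e1 : ∀ᶠ ε in 𝓝[>] (0 : ℝ), ∀ r ∈ S, Metric.closedBall r ε ⊆ W := by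
      rw [Filter.eventually_all_finset]
      intro r hr
      obtain ⟨δ, hδ, hδW⟩ := Metric.isOpen_iff.1 hW r (hSW r hr)
      filter_upwards [Ioo_mem_nhdsGT hδ] with ε hε
      exact (Metric.closedBall_subset_ball hε.2).trans hδW
    have e2 : ∀ᶠ ε in 𝓝[>] (0 : ℝ), ∀ r ∈ S, ∀ t ∈ S, r ≠ t → 2 * ε < dist r t := by
      rw [Filter.eventually_all_finset]
      intro r _
      rw [Filter.eventually_all_finset]
      intro t _
      by_cases hrt : r = t
      · simp [hrt]
      · filter_upwards [Ioo_mem_nhdsGT (half_pos (dist_pos.2 hrt))] with ε hε _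
        linarith [hε.2]
    obtain ⟨ε, ⟨h1, h2⟩, h3⟩ := ((e1.and e2).and self_mem_nhdsWithin).exists
    exact ⟨ε, h3, h1, h2⟩
  set U : Set ℂ := ⋃ r ∈ S, Metric.ball r ε with hU
  have hUo : IsOpen U := isOpen_biUnion fun _ _ => Metric.isOpen_ball
  have hN : {a : Fin m → ℂ | ∀ r ∈ (esymmHomeo m).symm a, r ∈ U} ∈ 𝓝 a₀ := by
    refine ((isOpen_setOf_forall_mem hUo).preimage (esymmHomeo m).symm.continuous).mem_nhds ?_
    intro r hr
    have : r ∈ S := Multiset.mem_toFinset.2 hr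
    exact Set.mem_biUnion this (Metric.mem_ball_self hε)
  -- a point of `U` lies in exactly one of the discs, and on none of the circles
  have hsph : ∀ w ∈ U, ∀ r ∈ S, w ∉ Metric.sphere r ε := by
    intro w hw r hr hwr
    obtain ⟨t, ht, hwt⟩ := Set.mem_iUnion₂.1 hw
    rw [Metric.mem_sphere] at hwr
    rw [Metric.mem_ball] at hwt
    by_cases hrt : r = t
    · subst hrt
      linarith
    · have := hεd r hr t ht hrt
      have h2 := dist_triangle_left r t w
      linarith
  have hone : ∀ w ∈ U, ∑ r ∈ S, (Metric.ball r ε).indicator ψ w = ψ w := by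
    intro w hw
    obtain ⟨t, ht, hwt⟩ := Set.mem_iUnion₂.1 hw
    rw [Finset.sum_eq_single t]
    · exact Set.indicator_of_mem hwt _
    · intro r hr hrt
      refine Set.indicator_of_notMem (fun hwr => ?_) _
      have := hεd r hr t ht hrt
      have h2 := dist_triangle_left r t w
      rw [Metric.mem_ball] at hwr hwt
      linarith
    · exact fun h => (h ht).elim
  have hsm : ContDiffAt ℂ ω (fun a : Fin m → ℂ => ∑ r ∈ S, (2 * Real.pi * Complex.I)⁻¹ *
      ∮ z in C(r, ε), ψ z * ((monicPoly a).derivative.eval z / (monicPoly a).eval z)) a₀ := by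
    refine ContDiffAt.sum fun r hr => contDiffAt_const.mul
      (contDiffAt_circleIntegral hε.le ?_ ?_)
    · exact hψ.continuousOn.mono (Metric.sphere_subset_closedBall.trans (hεW r hr))
    · intro z hz
      obtain ⟨x, hx⟩ := ofTuple_surjective ((esymmHomeo m).symm a₀)
      have hax : a₀ = esymmFun (ofTuple x) := by
        rw [hx, ← esymmHomeo_apply, Homeomorph.apply_symm_apply]
      rw [hax, eval_monicPoly_esymmFun, Finset.prod_ne_zero_iff]
      intro k _ h0
      refine hsph (x k) ?_ r hr (sub_eq_zero.1 h0 ▸ hz)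
      refine mem_of_mem_nhds hN (x k) ?_
      rw [← hx]
      exact mem_ofTuple.2 ⟨k, rfl⟩
  refine hsm.congr_of_eventuallyEq ?_
  filter_upwards [hN] with a ha
  obtain ⟨x, hx⟩ := ofTuple_surjective ((esymmHomeo m).symm a)
  have hax : a = esymmFun (ofTuple x) := by
    rw [hx, ← esymmHomeo_apply, Homeomorph.apply_symm_apply]
  have hxU : ∀ k, x k ∈ U := fun k => ha (x k) (by rw [← hx]; exact mem_ofTuple.2 ⟨k, rfl⟩)
  have hterm : ∀ r ∈ S, (2 * Real.pi * Complex.I)⁻¹ *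
      (∮ z in C(r, ε), ψ z * ((monicPoly a).derivative.eval z / (monicPoly a).eval z)) =
      ∑ k, (Metric.ball r ε).indicator ψ (x k) := by
    intro r hr
    rw [hax, circleIntegral_logDeriv hε (hψ.mono (hεW r hr)) x fun k => hsph _ (hxU k) r hr]
    rw [← mul_assoc, inv_mul_cancel₀ Complex.two_pi_I_ne_zero, one_mul]
  rw [Finset.sum_congr rfl hterm, Finset.sum_comm, Finset.sum_congr rfl fun k _ => hone _ (hxU k),
    ← hx]
  change ((Finset.univ.val.map x).map ψ).sum = _
  rw [Multiset.map_map]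
  rfl

/-- For `φ` holomorphic on `W`, the elementary symmetric functions of `φ r₁, …, φ r_m` are
holomorphic functions of the elementary symmetric functions of `r₁, …, r_m ∈ W`. -/
theorem contDiffOn_esymm_map {m : ℕ} {W : Set ℂ} (hW : IsOpen W) {φ : ℂ → ℂ}
    (hφ : DifferentiableOn ℂ φ W) (k : ℕ) :
    ContDiffOn ℂ ω (fun a : Fin m → ℂ => (((esymmHomeo m).symm a).1.map φ).esymm k)
      {a | ∀ r ∈ (esymmHomeo m).symm a, r ∈ W} := by
  induction k using Nat.strong_induction_on with
  | _ k ih =>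
    rcases Nat.eq_zero_or_pos k with rfl | hk
    · simpa [Multiset.esymm] using contDiffOn_const
    have hk0 : (k : ℂ) ≠ 0 := by exact_mod_cast hk.ne'
    have key : ∀ s : Sym ℂ m, (s.1.map φ).esymm k = (k : ℂ)⁻¹ * ((-1) ^ (k + 1) *
        ∑ p ∈ Finset.HasAntidiagonal.antidiagonal k with p.1 < k,
          (-1) ^ p.1 * (s.1.map φ).esymm p.1 * (s.1.map fun r => φ r ^ p.2).sum) := by
      intro s
      obtain ⟨x, rfl⟩ := ofTuple_surjective s
      have h := congrArg (MvPolynomial.aeval (φ ∘ x))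
        (MvPolynomial.mul_esymm_eq_sum (Fin m) ℂ k)
      simp only [map_mul, map_sum, map_pow, map_neg, map_one, map_natCast,
        MvPolynomial.aeval_esymm_eq_multiset_esymm, MvPolynomial.psum,
        MvPolynomial.aeval_X] at h
      have e1 : (ofTuple x).1.map φ = Finset.univ.val.map (φ ∘ x) :=
        Multiset.map_map φ x Finset.univ.val
      have e2 : ∀ j, ((ofTuple x).1.map fun r => φ r ^ j).sum = ∑ i, (φ ∘ x) i ^ j := fun j =>
        congrArg Multiset.sum (Multiset.map_map (fun r => φ r ^ j) x Finset.univ.val)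
      simp only [e1, e2]
      rw [← h, inv_mul_cancel_left₀ hk0]
    simp only [key]
    refine contDiffOn_const.mul (contDiffOn_const.mul (ContDiffOn.sum fun p hp => ?_))
    refine (contDiffOn_const.mul (ih p.1 (Finset.mem_filter.1 hp).2)).mul ?_
    exact contDiffOn_sum_map hW (hφ.pow p.2)

/-- The transition maps between the charts `Sym^m(g)` are holomorphic, so that `Sym^m(X)` is a
complex manifold of dimension `m`. -/
instance instIsManifoldSym {X : Type*} [TopologicalSpace X] [ChartedSpace ℂ X]
    [IsManifold 𝓘(ℂ) ω X] [T2Space X] [Nonempty X] {m : ℕ} :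
    IsManifold 𝓘(ℂ, Fin m → ℂ) ω (Sym X m) := by
  refine isManifold_of_contDiffOn _ _ _ ?_
  rintro _ _ ⟨g, hg, rfl⟩ ⟨g', hg', rfl⟩
  have hW : IsOpen (g.symm ≫ₕ g').source := (g.symm ≫ₕ g').open_source
  have hφ : DifferentiableOn ℂ (g' ∘ g.symm) (g.symm ≫ₕ g').source := by
    have h : ContMDiffOn 𝓘(ℂ) 𝓘(ℂ) ω (g' ∘ g.symm) (g.symm ≫ₕ g').source :=
      hg'.1.comp (hg.2.mono fun z hz => hz.1) fun z hz => hz.2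
    exact h.contDiffOn.differentiableOn (by simp)
  have hmain : ContDiffOn ℂ ω (fun a : Fin m → ℂ => fun k : Fin m =>
      (((esymmHomeo m).symm a).1.map (g' ∘ g.symm)).esymm (k.1 + 1))
      {a | ∀ r ∈ (esymmHomeo m).symm a, r ∈ (g.symm ≫ₕ g').source} :=
    contDiffOn_pi.2 fun k => contDiffOn_esymm_map hW hφ (k.1 + 1)
  refine (hmain.mono ?_).congr ?_
  · rintro a ⟨⟨h1, h2⟩, -⟩ r hr
    exact ⟨h1 r hr, h2 _ (Sym.mem_map.2 ⟨r, hr, rfl⟩)⟩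
  · rintro a -
    ext k
    change ((((esymmHomeo m).symm a).1.map g.symm).map g').esymm (k.1 + 1) = _
    rw [Multiset.map_map]

end SymProd

namespace BranchedCover

/-- The sphere punctured at the finitely many points of `B` and at `∞`, that is `ℂ ∖ B`. -/
def puncturedSphere (B : Finset ℂ) : TopologicalSpace.Opens ℂ :=
  ⟨{x | x ∉ B}, B.finite_toSet.isClosed.isOpen_compl⟩

/-- The double cover of `ℂ ∖ B` given by `y ^ 2 = ∏ b ∈ B, (x - b)`. If `B` has an odd number of
elements, this is the double branched cover of the sphere with branch set `B ∪ {∞}`, with the branch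
points removed. -/
@[ext]
structure DoubleCover (B : Finset ℂ) where
  /-- The coordinate on the base. -/
  x : ℂ
  /-- The square root of `∏ b ∈ B, (x - b)`. -/
  y : ℂ
  sq_eq : y ^ 2 = ∏ b ∈ B, (x - b)
  notMem : x ∉ B

variable {B : Finset ℂ}

/-- The double cover as a curve in `ℂ × ℂ`. -/
def DoubleCover.toProd (q : DoubleCover B) : ℂ × ℂ := (q.x, q.y)

/-- The double cover has the subspace topology of the curve in `ℂ × ℂ`. -/
instance : TopologicalSpace (DoubleCover B) :=
  TopologicalSpace.induced DoubleCover.toProd inferInstance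

theorem DoubleCover.isInducing_toProd :
    Topology.IsInducing (DoubleCover.toProd : DoubleCover B → ℂ × ℂ) := ⟨rfl⟩

theorem DoubleCover.toProd_injective :
    Function.Injective (DoubleCover.toProd : DoubleCover B → ℂ × ℂ) := fun _ _ h =>
  DoubleCover.ext (congrArg Prod.fst h) (congrArg Prod.snd h)

theorem DoubleCover.continuous_x : Continuous (DoubleCover.x : DoubleCover B → ℂ) :=
  continuous_fst.comp isInducing_toProd.continuous

theorem DoubleCover.continuous_y : Continuous (DoubleCover.y : DoubleCover B → ℂ) :=
  continuous_snd.comp isInducing_toProd.continuous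

instance : T2Space (DoubleCover B) :=
  T2Space.of_injective_continuous DoubleCover.toProd_injective
    DoubleCover.isInducing_toProd.continuous

/-- The covering projection. -/
def proj (q : DoubleCover B) : puncturedSphere B := ⟨q.x, q.notMem⟩

/-- The covering involution, interchanging the two preimages of a point. -/
def tau (q : DoubleCover B) : DoubleCover B := ⟨q.x, -q.y, by rw [neg_sq, q.sq_eq], q.notMem⟩

theorem proj_surjective : Function.Surjective (proj : DoubleCover B → puncturedSphere B) := by
  rintro ⟨x, hx⟩
  obtain ⟨y, hy⟩ := IsAlgClosed.exists_pow_nat_eq (∏ b ∈ B, (x - b)) two_pos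
  exact ⟨⟨x, y, hy, hx⟩, rfl⟩

instance : Nonempty (puncturedSphere B) := by
  obtain ⟨x, hx⟩ := B.exists_notMem
  exact ⟨⟨x, hx⟩⟩

instance : Nonempty (DoubleCover B) := ⟨(proj_surjective (Classical.arbitrary _)).choose⟩

theorem prod_ne_zero {x : ℂ} (hx : x ∉ B) : ∏ b ∈ B, (x - b) ≠ 0 := by
  rw [Finset.prod_ne_zero_iff]
  intro b hb h
  exact hx (sub_eq_zero.1 h ▸ hb)

theorem y_ne_zero (q : DoubleCover B) : q.y ≠ 0 := by
  intro h
  have h1 := q.sq_eq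
  rw [h, zero_pow two_ne_zero] at h1
  exact prod_ne_zero q.notMem h1.symm

theorem re_cpow_pos {u : ℂ} (hu : u ∈ Complex.slitPlane) : 0 < (u ^ (2⁻¹ : ℂ)).re := by
  have hu0 := Complex.slitPlane_ne_zero hu
  rw [Complex.cpow_def_of_ne_zero hu0, Complex.exp_re]
  have him : (Complex.log u * 2⁻¹).im = u.arg / 2 := by
    rw [show (2⁻¹ : ℂ) = ((2⁻¹ : ℝ) : ℂ) by push_cast; rfl, Complex.im_mul_ofReal, Complex.log_im]
    ring
  rw [him]
  refine mul_pos (Real.exp_pos _) (Real.cos_pos_of_mem_Ioo ⟨?_, ?_⟩)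
  · linarith [Complex.neg_pi_lt_arg u]
  · have := lt_of_le_of_ne (Complex.arg_le_pi u) (Complex.mem_slitPlane_iff_arg.1 hu).1
    linarith

theorem sq_mem_slitPlane {w : ℂ} (hw : 0 < w.re) : w ^ 2 ∈ Complex.slitPlane := by
  rw [Complex.mem_slitPlane_iff, sq, Complex.mul_re, Complex.mul_im]
  by_cases h : w.im = 0
  · left
    rw [h]
    nlinarith
  · right
    intro h2
    have : 2 * (w.re * w.im) = 0 := by linarith
    rcases mul_eq_zero.1 ((mul_eq_zero.1 this).resolve_left two_ne_zero) with h3 | h3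
    · exact hw.ne' h3
    · exact h h3

open Classical in
/-- The chart of the double cover around `q₀` given by the coordinate `x`. -/
def sheetChart (q₀ : DoubleCover B) : OpenPartialHomeomorph (DoubleCover B) ℂ where
  toFun q := q.x
  invFun x := if h : x ∉ B then
      ⟨x, q₀.y * ((∏ b ∈ B, (x - b)) / q₀.y ^ 2) ^ (2⁻¹ : ℂ), by
        have h0 := y_ne_zero q₀
        have h2 := Complex.cpow_nat_inv_pow ((∏ b ∈ B, (x - b)) / q₀.y ^ 2) two_ne_zero
        push_cast at h2
        rw [mul_pow, h2]
        field_simp, h⟩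
    else q₀
  source := {q | 0 < (q.y / q₀.y).re}
  target := {x | x ∉ B ∧ (∏ b ∈ B, (x - b)) / q₀.y ^ 2 ∈ Complex.slitPlane}
  map_source' := by
    intro q hq
    refine ⟨q.notMem, ?_⟩
    rw [← q.sq_eq, ← div_pow]
    exact sq_mem_slitPlane hq
  map_target' := by
    rintro x ⟨hx, hx2⟩
    rw [dif_pos hx]
    change 0 < (q₀.y * _ / q₀.y).re
    rw [mul_div_cancel_left₀ _ (y_ne_zero q₀)]
    exact re_cpow_pos hx2
  left_inv' := by
    intro q hq
    rw [dif_pos q.notMem]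
    refine DoubleCover.ext rfl ?_
    change q₀.y * _ = q.y
    rw [← q.sq_eq, ← div_pow, Complex.sq_cpow_two_inv hq, mul_div_cancel₀ _ (y_ne_zero q₀)]
  right_inv' := by
    rintro x ⟨hx, hx2⟩
    rw [dif_pos hx]
  open_source :=
    isOpen_lt continuous_const
      (Complex.continuous_re.comp (DoubleCover.continuous_y.div_const _))
  open_target := by
    have h : IsOpen {x : ℂ | x ∉ B} := B.finite_toSet.isClosed.isOpen_compl
    refine h.inter (Complex.isOpen_slitPlane.preimage ?_)
    fun_prop
  continuousOn_toFun := DoubleCover.continuous_x.continuousOn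
  continuousOn_invFun := by
    rw [DoubleCover.isInducing_toProd.continuousOn_iff]
    have : ContinuousOn (fun x : ℂ =>
        (x, q₀.y * ((∏ b ∈ B, (x - b)) / q₀.y ^ 2) ^ (2⁻¹ : ℂ)))
        {x | x ∉ B ∧ (∏ b ∈ B, (x - b)) / q₀.y ^ 2 ∈ Complex.slitPlane} := by
      refine continuousOn_id.prodMk (continuousOn_const.mul ?_)
      refine ContinuousOn.cpow_const (by fun_prop) fun x hx => hx.2
    refine this.congr fun x hx => ?_
    have hxB : x ∉ B := hx.1
    simp [hxB, DoubleCover.toProd]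

/-- The complex structure of the double cover, pulled back from `ℂ ∖ B` along the projection. -/
instance : ChartedSpace ℂ (DoubleCover B) where
  atlas := Set.range sheetChart
  chartAt := sheetChart
  mem_chart_source q := by
    change 0 < (q.y / q.y).re
    rw [div_self (y_ne_zero q)]
    simp
  chart_mem_atlas q := ⟨q, rfl⟩

instance : IsManifold 𝓘(ℂ) ω (DoubleCover B) := by
  refine isManifold_of_contDiffOn _ _ _ ?_
  rintro _ _ ⟨q, rfl⟩ ⟨q', rfl⟩
  refine contDiffOn_id.congr ?_
  rintro x ⟨⟨hx, -⟩, -⟩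
  exact (sheetChart q).right_inv hx

/-- A choice of one of the two preimages of each point. -/
def lift (x : puncturedSphere B) : DoubleCover B := Function.surjInv proj_surjective x

/-- The map `x₁ ⋯ x_m ↦ x̃₁ τ(x̃₁) ⋯ x̃_m τ(x̃_m)` from `Sym^m` of the punctured sphere to
`Sym^{2m}` of its double cover, where `x̃` is either preimage of `x`. -/
def symEmbedding (B : Finset ℂ) (m : ℕ) (s : Sym (puncturedSphere B) m) :
    Sym (DoubleCover B) (2 * m) :=
  ⟨s.1.map lift + s.1.map fun x => tau (lift x), by
    rw [Multiset.card_add, Multiset.card_map, Multiset.card_map, s.2, two_mul]⟩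

end BranchedCover

namespace ComplexBundle

open Bundle

section Normal

variable {E₁ H₁ P E₂ H₂ M : Type*}
  [NormedAddCommGroup E₁] [NormedSpace ℂ E₁] [TopologicalSpace H₁] (I : ModelWithCorners ℂ E₁ H₁)
  [TopologicalSpace P] [ChartedSpace H₁ P]
  [NormedAddCommGroup E₂] [NormedSpace ℂ E₂] [TopologicalSpace H₂] (J : ModelWithCorners ℂ E₂ H₂)
  [TopologicalSpace M] [ChartedSpace H₂ M]

/-- The tangent space at `p` of the image of an embedding `f`, as a complex subspace of the tangent
space of the ambient manifold: the vectors `df(u)` with `u` tangent to the source at a point over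
`p`. (For injective `f` these vectors already form a subspace.) -/
def imageTangentSpace (f : P → M) (p : M) : Submodule ℂ (TangentSpace J p) :=
  Submodule.span ℂ {v | (⟨p, v⟩ : TangentBundle J M) ∈ Set.range (tangentMap I J f)}

/-- The fibres `T_p M / T_p N` of the normal bundle of the image `N` of an embedding `f`. -/
def NormalBundle (f : P → M) (p : Set.range f) : Type _ :=
  TangentSpace J (p : M) ⧸ imageTangentSpace I J f p

instance (f : P → M) (p : Set.range f) : AddCommGroup (NormalBundle I J f p) :=
  inferInstanceAs (AddCommGroup (TangentSpace J (p : M) ⧸ imageTangentSpace I J f p))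

instance (f : P → M) (p : Set.range f) : Module ℂ (NormalBundle I J f p) :=
  inferInstanceAs (Module ℂ (TangentSpace J (p : M) ⧸ imageTangentSpace I J f p))

/-- The projection of the restriction of the tangent bundle of `M` to `N` to the normal bundle. -/
def toNormalBundle (F : Type*) (f : P → M) (v : {v : TangentBundle J M // v.proj ∈ Set.range f}) :
    TotalSpace F (NormalBundle I J f) :=
  ⟨⟨v.1.proj, v.2⟩, (imageTangentSpace I J f v.1.proj).mkQ v.1.snd⟩

/-- The normal bundle carries the quotient topology of the restriction of the tangent bundle. -/
instance [IsManifold J 1 M] (F : Type*) (f : P → M) :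
    TopologicalSpace (TotalSpace F (NormalBundle I J f)) :=
  TopologicalSpace.coinduced (toNormalBundle I J F f) inferInstance

end Normal

/-- A complex vector bundle with model fibre `F` is trivial if it has a fibrewise `ℂ`-linear
trivialization over the whole base. -/
def IsTrivial {X : Type*} [TopologicalSpace X] (F : Type*) [NormedAddCommGroup F]
    [NormedSpace ℂ F] (E : X → Type*) [∀ x, AddCommMonoid (E x)] [∀ x, Module ℂ (E x)]
    [TopologicalSpace (TotalSpace F E)] : Prop :=
  ∃ e : Trivialization F (TotalSpace.proj : TotalSpace F E → X),
    e.IsLinear ℂ ∧ e.baseSet = Set.univ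

end ComplexBundle

namespace BranchedCover

open Bundle ComplexBundle

/-- The submanifold `M^inv` of `M = Sym^{2n-2}` of the punctured double cover: the image of
`Sym^{n-1}` of the punctured sphere. -/
abbrev Minv (B : Finset ℂ) (n : ℕ) : Set (Sym (DoubleCover B) (2 * (n - 1))) :=
  Set.range (symEmbedding B (n - 1))

/-- The normal bundle of `M^inv` in `M`. -/
abbrev normalMinv (B : Finset ℂ) (n : ℕ) : Minv B n → Type :=
  NormalBundle 𝓘(ℂ, Fin (n - 1) → ℂ) 𝓘(ℂ, Fin (2 * (n - 1)) → ℂ) (symEmbedding B (n - 1))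

/-- The pullback of the normal bundle of `M^inv` to `M^inv × [0,1]`. -/
abbrev upsilonMinv (B : Finset ℂ) (n : ℕ) : Minv B n × unitInterval → Type :=
  (Prod.fst : Minv B n × unitInterval → Minv B n) *ᵖ (normalMinv B n)

end BranchedCover

end

/-!
The normal bundle is trivialized by the odd holomorphic differentials `x ^ j dx / y`, `j < m`, where
`m = n - 1`. The cotangent space of `Sym^{2m}` of the double cover at a divisor `D` is the space of
differentials modulo those vanishing on `D`. At an invariant divisor `D`, the preimage of
`x₁ + ⋯ + x_m`, the conormal space of `M^inv` is the odd part, that is, the space of differentials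
`u(x) dx / y` with `u` a polynomial modulo `P = ∏ k, (X - x k)`; so `1, X, …, X ^ (m - 1)` is a frame
of the conormal bundle, even where some of the points `x k` coincide.

To avoid integrating `x ^ j dx / y`, only exact differentials are used: with `Q = ∏ b ∈ B, (X - b)`
one has `d(y p(x)) = (Q' p / 2 + Q p')(x) dx / y`, and `p ↦ Q' p / 2 + Q p'` is onto modulo `P` since
`Q` does not vanish at the points `x k` (`exists_dvd_oddDeriv_sub`), already on polynomials of degree
less than `2 * m`. Let `E` be the vector of the traces `D ↦ ∑ q ∈ D, y(q) x(q) ^ i`, `i < 2 * m`, and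
let `A` be the matrix of `p ↦ Q' p / 2 + Q p'` modulo `P`, which depends continuously on `D`. The
linear relations between the components of `dE` at `D` are exactly the kernel of `A`
(`oddMatrix_mulVec_eq_zero_iff_mfderiv`). Hence, for a continuous right inverse `R` of `A`, the
combinations of the components of `dE` given by `R` are linearly independent and have the kernel of
`dE` as their common kernel. Since `E` vanishes on `M^inv` and the embedding is an immersion, that
kernel is the tangent space of `M^inv` by a dimension count (`imageTangentSpace_symEmbedding`), and a
continuous fibrewise surjection with this kernel trivializes the normal bundle
(`isTrivial_normalBundle`).

The description of the cotangent space (`fderiv_sum_map_eq_zero_iff`) is proved in a local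
coordinate. If `ψ'` vanishes on the divisor of a polynomial `P₀`, then `ψ` varies near a root by
`o(P₀)`, and at a root of a nearby monic polynomial `P₁` the value of `P₀` is `O(‖P₁ - P₀‖)`; so the
sum of `ψ` over the roots has derivative zero. Conversely Hermite interpolation reduces to
polynomials `ψ`, for which the power sums are coordinates by Newton's identities.
-/

noncomputable section

open scoped Manifold ContDiff Topology

/-! ### Trivializations of normal bundles -/

namespace ComplexBundle

open Bundle

section Trivialization

variable {E₁ H₁ P E₂ H₂ M F : Type*}
  [NormedAddCommGroup E₁] [NormedSpace ℂ E₁] [TopologicalSpace H₁] {I : ModelWithCorners ℂ E₁ H₁}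
  [TopologicalSpace P] [ChartedSpace H₁ P]
  [NormedAddCommGroup E₂] [NormedSpace ℂ E₂] [TopologicalSpace H₂] {J : ModelWithCorners ℂ E₂ H₂}
  [TopologicalSpace M] [ChartedSpace H₂ M] [IsManifold J 1 M]
  [NormedAddCommGroup F] [NormedSpace ℂ F]

/-- Continuous, fibrewise linear and surjective maps on a restricted tangent bundle have
continuous local right inverses. -/
theorem exists_local_section [FiniteDimensional ℂ F] {S : Set M}
    (θ : ∀ p : S, TangentSpace J (p : M) →ₗ[ℂ] F)
    (hθ : Continuous fun v : {v : TangentBundle J M // v.proj ∈ S} =>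
      θ ⟨v.1.proj, v.2⟩ v.1.snd)
    (hsurj : ∀ p, Function.Surjective (θ p)) (p₀ : S) :
    ∃ U ∈ 𝓝 p₀, ∃ σ : S × F → {v : TangentBundle J M // v.proj ∈ S},
      ContinuousOn σ (U ×ˢ Set.univ) ∧ ∀ q ∈ U, ∀ c : F,
        (σ (q, c)).1.proj = q ∧ θ ⟨(σ (q, c)).1.proj, (σ (q, c)).2⟩ (σ (q, c)).1.snd = c := by
  classical
  let e := trivializationAt E₂ (TangentSpace J : M → Type _) (p₀ : M)
  have hp₀ : (p₀ : M) ∈ e.baseSet := mem_baseSet_trivializationAt _ _ _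
  -- a right inverse over the base point, read in the local trivialization `e`
  obtain ⟨R, hR⟩ := (θ p₀).exists_rightInverse_of_surjective
    (LinearMap.range_eq_top.2 (hsurj p₀))
  let R₀ : F →ₗ[ℂ] E₂ := (e.linearMapAt ℂ (p₀ : M)) ∘ₗ R
  have hR₀c : Continuous R₀ := R₀.continuous_of_finiteDimensional
  let V : Set S := {q | (q : M) ∈ e.baseSet}
  have hVo : IsOpen V := e.open_baseSet.preimage continuous_subtype_val
  let s : S × F → TangentBundle J M := fun w => ⟨w.1, e.symmₗ ℂ (w.1 : M) (R₀ w.2)⟩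
  have hs : ContinuousOn s (V ×ˢ Set.univ) := by
    have h1 : ContinuousOn (fun w : S × F => e.toOpenPartialHomeomorph.symm ((w.1 : M), R₀ w.2))
        (V ×ˢ Set.univ) := by
      refine e.toOpenPartialHomeomorph.continuousOn_symm.comp (Continuous.continuousOn ?_) ?_
      · exact (continuous_subtype_val.comp continuous_fst).prodMk (hR₀c.comp continuous_snd)
      · rintro ⟨q, c⟩ ⟨hq, -⟩
        exact e.mem_target.2 hq
    refine h1.congr ?_
    rintro ⟨q, c⟩ ⟨hq, -⟩
    change (⟨(q : M), e.symmₗ ℂ (q : M) (R₀ c)⟩ : TangentBundle J M) = _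
    rw [e.coe_symmₗ hq]
    exact e.mk_symm hq (R₀ c)
  let s' : S × F → {v : TangentBundle J M // v.proj ∈ S} := fun w => ⟨s w, w.1.2⟩
  have hs' : ContinuousOn s' (V ×ˢ Set.univ) :=
    continuousOn_iff_continuous_domRestrict.2
      ((continuousOn_iff_continuous_domRestrict.1 hs).subtype_mk _)
  let A : S → F →L[ℂ] F := fun q =>
    LinearMap.toContinuousLinearMap ((θ q) ∘ₗ (e.symmₗ ℂ (q : M)) ∘ₗ R₀)
  have hA : ContinuousOn A V := by
    refine continuousOn_clm_apply.2 fun c => ?_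
    have h2 : ContinuousOn (fun q : S => s' (q, c)) V :=
      hs'.comp (f := fun q : S => (q, c)) (by fun_prop) fun q hq => ⟨hq, trivial⟩
    exact hθ.comp_continuousOn h2
  have hA₀ : A p₀ = 1 := by
    ext c
    change θ p₀ (e.symmₗ ℂ (p₀ : M) (e.linearMapAt ℂ (p₀ : M) (R c))) = c
    rw [e.symmₗ_linearMapAt hp₀]
    exact LinearMap.congr_fun hR c
  have hinv : ∀ᶠ q in 𝓝 p₀, IsUnit (A q) :=
    (hA.continuousAt (hVo.mem_nhds hp₀)).eventually
      (Units.isOpen.mem_nhds (by rw [hA₀]; exact isUnit_one))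
  let U : Set S := V ∩ {q | IsUnit (A q)}
  have hU : U ∈ 𝓝 p₀ := Filter.inter_mem (hVo.mem_nhds hp₀) hinv
  have hAi : ContinuousOn (fun q => Ring.inverse (A q)) U := by
    intro q hq
    obtain ⟨u, hu⟩ := hq.2
    have h1 : ContinuousAt Ring.inverse (A q) := hu ▸ NormedRing.inverse_continuousAt u
    exact h1.comp_continuousWithinAt ((hA q hq.1).mono Set.inter_subset_left)
  refine ⟨U, hU, fun w => s' (w.1, Ring.inverse (A w.1) w.2), ?_, ?_⟩
  · refine hs'.comp (f := fun w : S × F => (w.1, Ring.inverse (A w.1) w.2)) ?_ ?_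
    · refine continuousOn_fst.prodMk (ContinuousOn.clm_apply ?_ continuousOn_snd)
      exact hAi.comp continuousOn_fst fun w hw => hw.1
    · rintro ⟨q, c⟩ ⟨hq, -⟩
      exact ⟨hq.1, trivial⟩
  · intro q hq c
    refine ⟨rfl, ?_⟩
    change A q (Ring.inverse (A q) c) = c
    rw [← mul_apply_eq_comp, Ring.mul_inverse_cancel _ hq.2]
    rfl

/-- A continuous, fibrewise linear and surjective map from the restricted tangent bundle of `M` to
a fixed vector space, whose kernel is the tangent bundle of the submanifold, trivializes the normal
bundle. -/
theorem isTrivial_normalBundle [FiniteDimensional ℂ F] (f : P → M)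
    (θ : ∀ p : Set.range f, TangentSpace J (p : M) →ₗ[ℂ] F)
    (hθ : Continuous fun v : {v : TangentBundle J M // v.proj ∈ Set.range f} =>
      θ ⟨v.1.proj, v.2⟩ v.1.snd)
    (hsurj : ∀ p, Function.Surjective (θ p))
    (hker : ∀ p, LinearMap.ker (θ p) = imageTangentSpace I J f p) :
    IsTrivial F (NormalBundle I J f) := by
  let L : ∀ p : Set.range f, NormalBundle I J f p ≃ₗ[ℂ] F := fun p =>
    (Submodule.quotEquivOfEq _ _ (hker p).symm).trans
      ((θ p).quotKerEquivOfSurjective (hsurj p))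
  have hL : ∀ (p : Set.range f) (v : TangentSpace J (p : M)),
      L p ((imageTangentSpace I J f p).mkQ v) = θ p v := fun p v => rfl
  let φ : TotalSpace F (NormalBundle I J f) ≃ Set.range f × F :=
    { toFun := fun w => (w.1, L w.1 w.2)
      invFun := fun w => ⟨w.1, (L w.1).symm w.2⟩
      left_inv := by
        rintro ⟨p, v⟩
        simp
      right_inv := by
        rintro ⟨p, v⟩
        simp }
  have hφ : Continuous φ := by
    refine continuous_coinduced_dom.2 ?_
    exact ((FiberBundle.continuous_proj E₂ (TangentSpace J : M → Type _)).comp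
      continuous_subtype_val).subtype_mk _ |>.prodMk hθ
  have hφ' : Continuous φ.symm := by
    rw [continuous_iff_continuousAt]
    rintro ⟨p₀, c₀⟩
    obtain ⟨U, hU, σ, hσ, h⟩ := exists_local_section θ hθ hsurj p₀
    have hN : U ×ˢ Set.univ ∈ 𝓝 (p₀, c₀) := prod_mem_nhds hU Filter.univ_mem
    have h1 : ContinuousAt (fun w => toNormalBundle I J F f (σ w)) (p₀, c₀) :=
      (continuous_coinduced_rng (f := toNormalBundle I J F f)).continuousAt.comp
        (hσ.continuousAt hN)
    refine h1.congr ?_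
    filter_upwards [hN] with w hw
    refine φ.injective ?_
    rw [φ.apply_symm_apply]
    exact Prod.ext (Subtype.ext (h w.1 hw.1 w.2).1) (h w.1 hw.1 w.2).2
  let Φ : TotalSpace F (NormalBundle I J f) ≃ₜ Set.range f × F := ⟨φ, hφ, hφ'⟩
  refine ⟨{ Φ.toOpenPartialHomeomorph with
      baseSet := Set.univ
      open_baseSet := isOpen_univ
      source_eq := rfl
      target_eq := by simp
      proj_toFun := fun _ _ => rfl }, ⟨fun p _ => ?_⟩, rfl⟩
  exact ⟨(L p).map_add, (L p).map_smul⟩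

/-- Pullbacks of trivial bundles are trivial. -/
theorem IsTrivial.pullback {X Y : Type*} [TopologicalSpace X] [TopologicalSpace Y] {E : X → Type*}
    [∀ x, AddCommMonoid (E x)] [∀ x, Module ℂ (E x)] [TopologicalSpace (TotalSpace F E)]
    (h : IsTrivial F E) (g : C(Y, X)) : IsTrivial F ((g : Y → X) *ᵖ E) := by
  obtain ⟨e, he, hb⟩ := h
  refine ⟨e.pullback g, inferInstance, ?_⟩
  change g ⁻¹' e.baseSet = Set.univ
  rw [hb, Set.preimage_univ]

end Trivialization

end ComplexBundle

namespace SymProd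

open Filter Asymptotics

/-! ### Sums over the roots of a polynomial -/

theorem exists_perm_of_ofTuple_eq {X : Type*} {m : ℕ} {x y : Fin m → X}
    (h : ofTuple x = ofTuple y) : ∃ σ : Equiv.Perm (Fin m), y ∘ σ = x := by
  classical
  have hcount : ∀ p, Fintype.card {i // x i = p} = Fintype.card {i // y i = p} := by
    intro p
    have h1 := congrArg (fun s : Sym X m => s.1.count p) h
    simp only [ofTuple, Multiset.count_map] at h1
    rw [Fintype.card_subtype, Fintype.card_subtype]
    simpa [Finset.card, eq_comm] using h1
  refine ⟨Equiv.ofFiberEquiv fun p => Fintype.equivOfCardEq (hcount p), funext fun i => ?_⟩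
  exact Equiv.ofFiberEquiv_map _ _

theorem isOpenMap_ofTuple {X : Type*} [TopologicalSpace X] {m : ℕ} :
    IsOpenMap (ofTuple : (Fin m → X) → Sym X m) := by
  intro U hU
  rw [← isQuotientMap_ofTuple.isOpen_preimage]
  have : ofTuple ⁻¹' (ofTuple '' U : Set (Sym X m)) =
      ⋃ σ : Equiv.Perm (Fin m), (fun y : Fin m → X => y ∘ σ) ⁻¹' U := by
    ext y
    simp only [Set.mem_preimage, Set.mem_image, Set.mem_iUnion]
    constructor
    · rintro ⟨x, hx, h⟩
      obtain ⟨σ, rfl⟩ := exists_perm_of_ofTuple_eq h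
      exact ⟨σ, hx⟩
    · rintro ⟨σ, h⟩
      refine ⟨_, h, Subtype.ext ?_⟩
      change Multiset.map (y ∘ σ) Finset.univ.val = Multiset.map y Finset.univ.val
      rw [← Multiset.map_map, Multiset.map_univ_val_equiv]
  rw [this]
  exact isOpen_iUnion fun σ => hU.preimage (by fun_prop)

theorem sum_map_ofTuple {X : Type*} {m : ℕ} (ψ : X → ℂ) (x : Fin m → X) :
    ((ofTuple x).1.map ψ).sum = ∑ k, ψ (x k) := by
  change ((Finset.univ.val.map x).map ψ).sum = _
  rw [Multiset.map_map]
  rfl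

theorem symm_esymmFun_ofTuple {m : ℕ} (x : Fin m → ℂ) :
    (esymmHomeo m).symm (esymmFun (ofTuple x)) = ofTuple x := by
  rw [← esymmHomeo_apply, Homeomorph.symm_apply_apply]

/-- If the derivative of `ψ` vanishes at least as fast as `∏ j, (z - x j)`, then `ψ - ψ (x k)`
vanishes faster than this product. -/
theorem sub_isLittleO_prod {m : ℕ} {ψ : ℂ → ℂ} {x : Fin m → ℂ} (k : Fin m)
    (hψ : ∀ᶠ z in 𝓝 (x k), DifferentiableAt ℂ ψ z)
    (hO : deriv ψ =O[𝓝 (x k)] fun z => ∏ j, (z - x j)) :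
    (fun z => ψ z - ψ (x k)) =o[𝓝 (x k)] fun z => ∏ j, (z - x j) := by
  obtain ⟨C, hC, hO⟩ := hO.exists_pos
  rw [IsBigOWith] at hO
  have hfar : ∀ᶠ z in 𝓝 (x k), ∀ j, x j ≠ x k → 3 * ‖z - x k‖ ≤ ‖x j - x k‖ := by
    rw [eventually_all]
    intro j
    by_cases hj : x j = x k
    · simp [hj]
    · have h1 : Tendsto (fun z => 3 * ‖z - x k‖) (𝓝 (x k)) (𝓝 0) := by
        have : ContinuousAt (fun z => 3 * ‖z - x k‖) (x k) := by fun_prop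
        simpa [ContinuousAt] using this
      filter_upwards [h1.eventually_lt_const (norm_pos_iff.2 (sub_ne_zero.2 hj))] with z hz _
      exact hz.le
  obtain ⟨δ, hδ, hball⟩ := Metric.eventually_nhds_iff_ball.1 ((hψ.and hO).and hfar)
  have hmain : (fun z => ψ z - ψ (x k)) =O[𝓝 (x k)]
      fun z => (∏ j, (z - x j)) * (z - x k) := by
    refine IsBigO.of_bound (C * 2 ^ m) ?_
    filter_upwards [Metric.ball_mem_nhds _ hδ] with z hz
    have hsub : Metric.closedBall (x k) ‖z - x k‖ ⊆ Metric.ball (x k) δ := by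
      refine Metric.closedBall_subset_ball ?_
      rwa [← dist_eq_norm]
    have hz0 : ∀ j, x j ≠ x k → 3 * ‖z - x k‖ ≤ ‖x j - x k‖ := (hball z hz).2
    -- on the disc through `z` every factor is at most twice its value at `z`
    have hfac : ∀ w ∈ Metric.closedBall (x k) ‖z - x k‖, ∀ j, ‖w - x j‖ ≤ 2 * ‖z - x j‖ := by
      intro w hw j
      rw [mem_closedBall_iff_norm] at hw
      by_cases hj : x j = x k
      · rw [hj]
        linarith [norm_nonneg (z - x k)]
      · have h1 := hz0 j hj
        have h2 : ‖w - x j‖ ≤ ‖w - x k‖ + ‖x j - x k‖ := by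
          rw [norm_sub_rev (x j)]
          exact norm_sub_le_norm_sub_add_norm_sub _ _ _
        have h3 : ‖x j - x k‖ ≤ ‖z - x k‖ + ‖z - x j‖ := by
          have := norm_sub_le_norm_sub_add_norm_sub (x j) z (x k)
          rw [norm_sub_rev (x j) z] at this
          linarith
        linarith
    have hder : ∀ w ∈ Metric.closedBall (x k) ‖z - x k‖,
        ‖deriv ψ w‖ ≤ C * 2 ^ m * ‖∏ j, (z - x j)‖ := by
      intro w hw
      refine ((hball w (hsub hw)).1.2).trans ?_
      rw [mul_assoc]
      refine mul_le_mul_of_nonneg_left ?_ hC.le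
      rw [norm_prod, norm_prod]
      calc ∏ j, ‖w - x j‖ ≤ ∏ j, 2 * ‖z - x j‖ :=
            Finset.prod_le_prod (fun _ _ => norm_nonneg _) fun j _ => hfac w hw j
        _ = 2 ^ m * ∏ j, ‖z - x j‖ := by rw [Finset.prod_mul_distrib]; simp
    have := (convex_closedBall (x k) ‖z - x k‖).norm_image_sub_le_of_norm_deriv_le
      (fun w hw => (hball w (hsub hw)).1.1) hder
      (Metric.mem_closedBall_self (norm_nonneg _))
      (show z ∈ _ by rw [mem_closedBall_iff_norm])
    rw [norm_mul]
    linarith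
  refine hmain.trans_isLittleO ?_
  have h0 : Tendsto (fun z => z - x k) (𝓝 (x k)) (𝓝 0) := by
    have : ContinuousAt (fun z => z - x k) (x k) := by fun_prop
    simpa [ContinuousAt] using this
  simpa using (isBigO_refl (fun z => ∏ j, (z - x j)) (𝓝 (x k))).mul_isLittleO
    ((isLittleO_one_iff ℂ).2 h0)

theorem norm_eval_monicPoly_sub_le {m : ℕ} (a b : Fin m → ℂ) (z : ℂ) :
    ‖(monicPoly a).eval z - (monicPoly b).eval z‖ ≤ (m * (1 + ‖z‖) ^ m) * ‖a - b‖ := by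
  have h1 : (monicPoly a).eval z - (monicPoly b).eval z =
      ∑ k : Fin m, (-1) ^ (k.1 + 1) * (a k - b k) * z ^ (m - (k.1 + 1)) := by
    simp only [monicPoly, Polynomial.eval_add, Polynomial.eval_finsetSum, Polynomial.eval_mul,
      Polynomial.eval_C, Polynomial.eval_pow, Polynomial.eval_X]
    rw [add_sub_add_left_eq_sub, ← Finset.sum_sub_distrib]
    exact Finset.sum_congr rfl fun k _ => by ring
  rw [h1]
  refine (norm_sum_le _ _).trans ?_
  have h2 : ∀ k ∈ (Finset.univ : Finset (Fin m)),
      ‖(-1) ^ (k.1 + 1) * (a k - b k) * z ^ (m - (k.1 + 1))‖ ≤ (1 + ‖z‖) ^ m * ‖a - b‖ := by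
    intro k _
    rw [norm_mul, norm_mul, norm_pow, norm_pow, norm_neg, norm_one, one_pow, one_mul, mul_comm]
    refine mul_le_mul ?_ (norm_le_pi_norm (a - b) k) (norm_nonneg _) (by positivity)
    calc ‖z‖ ^ (m - (k.1 + 1)) ≤ (1 + ‖z‖) ^ (m - (k.1 + 1)) :=
          pow_le_pow_left₀ (norm_nonneg _) (by linarith) _
      _ ≤ (1 + ‖z‖) ^ m := pow_le_pow_right₀ (by linarith [norm_nonneg z]) (Nat.sub_le _ _)
  refine (Finset.sum_le_sum h2).trans (le_of_eq ?_)
  simp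
  ring

/-- If the derivative of `ψ` vanishes on the divisor `x₁ + ⋯ + x_m`, then the differential of
`∑ ψ (r)`, the sum being over the roots `r` of a polynomial, vanishes at the polynomial with roots
`x₁, …, x_m`. -/
theorem hasFDerivAt_sum_map_zero {m : ℕ} {ψ : ℂ → ℂ} {x : Fin m → ℂ}
    (hψ : ∀ k, ∀ᶠ z in 𝓝 (x k), DifferentiableAt ℂ ψ z)
    (hO : ∀ k, deriv ψ =O[𝓝 (x k)] fun z => ∏ j, (z - x j)) :
    HasFDerivAt (fun a : Fin m → ℂ => (((esymmHomeo m).symm a).1.map ψ).sum)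
      (0 : (Fin m → ℂ) →L[ℂ] ℂ) (esymmFun (ofTuple x)) := by
  set a₀ := esymmFun (ofTuple x) with ha₀
  let R : ℝ := 2 + ‖x‖
  have hR : 0 < R := by positivity
  refine HasFDerivAt.of_isLittleO (IsLittleO.of_bound fun c hc => ?_)
  let K : ℝ := m * (1 + R) ^ m
  have hK : 0 ≤ K := by positivity
  let ε : ℝ := c / (m * K + 1)
  have hε : 0 < ε := by positivity
  -- ordered tuples near `x` on which the local estimates hold
  have hev : ∀ᶠ y : Fin m → ℂ in 𝓝 x, ∀ k,
      ‖ψ (y k) - ψ (x k)‖ ≤ ε * ‖∏ j, (y k - x j)‖ ∧ ‖y k‖ ≤ R := by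
    rw [eventually_all]
    intro k
    have h1 := (sub_isLittleO_prod k (hψ k) (hO k)).bound hε
    have h2 : ∀ᶠ z in 𝓝 (x k), ‖z‖ ≤ R := by
      have h3 : ‖x k‖ < R := by
        have := norm_le_pi_norm x k
        simp only [R]
        linarith
      exact (continuous_norm.continuousAt.eventually_lt_const h3).mono fun _ h => h.le
    exact (continuous_apply k).continuousAt.eventually (h1.and h2)
  have hnhds : ∀ᶠ s in 𝓝 (ofTuple x), ∃ y : Fin m → ℂ, ofTuple y = s ∧ ∀ k,
      ‖ψ (y k) - ψ (x k)‖ ≤ ε * ‖∏ j, (y k - x j)‖ ∧ ‖y k‖ ≤ R := by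
    refine mem_of_superset (isOpenMap_ofTuple.image_mem_nhds hev) ?_
    rintro _ ⟨y, hy, rfl⟩
    exact ⟨y, rfl, hy⟩
  have hsymm : Tendsto (esymmHomeo m).symm (𝓝 a₀) (𝓝 (ofTuple x)) := by
    have := (esymmHomeo m).symm.continuous.continuousAt (x := a₀)
    rwa [ContinuousAt, ha₀, symm_esymmFun_ofTuple] at this
  filter_upwards [hsymm.eventually hnhds] with a ha
  obtain ⟨y, hy, hyb⟩ := ha
  have hay : a = esymmFun (ofTuple y) := by
    rw [hy, ← esymmHomeo_apply, Homeomorph.apply_symm_apply]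
  simp only [zero_apply, sub_zero]
  rw [← hy, ha₀, symm_esymmFun_ofTuple, sum_map_ofTuple, sum_map_ofTuple,
    ← Finset.sum_sub_distrib, ← ha₀]
  have hk : ∀ k ∈ (Finset.univ : Finset (Fin m)), ‖ψ (y k) - ψ (x k)‖ ≤ ε * (K * ‖a - a₀‖) := by
    intro k _
    refine (hyb k).1.trans (mul_le_mul_of_nonneg_left ?_ hε.le)
    have h0 : (monicPoly a).eval (y k) = 0 := by
      rw [hay, eval_monicPoly_esymmFun]
      exact Finset.prod_eq_zero (Finset.mem_univ k) (sub_self _)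
    have h1 := norm_eval_monicPoly_sub_le a a₀ (y k)
    rw [h0, zero_sub, norm_neg, ha₀, eval_monicPoly_esymmFun, ← ha₀] at h1
    refine h1.trans (mul_le_mul_of_nonneg_right ?_ (norm_nonneg _))
    exact mul_le_mul_of_nonneg_left
      (pow_le_pow_left₀ (by positivity) (by linarith [(hyb k).2]) _) (by positivity)
  refine (norm_sum_le _ _).trans ((Finset.sum_le_sum hk).trans ?_)
  rw [Finset.sum_const, Finset.card_univ, Fintype.card_fin, nsmul_eq_mul]
  have h2 : m * (ε * K) ≤ c := by
    have : ε * (m * K + 1) = c := by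
      simp only [ε]
      field_simp
    nlinarith
  nlinarith [norm_nonneg (a - a₀)]

/-- Hermite interpolation: modulo `∏ k, (z - x k)` every holomorphic function is a polynomial of
degree less than `m`. -/
theorem exists_polynomial_interpolation {W : Set ℂ} (hW : IsOpen W) {m : ℕ} {ψ : ℂ → ℂ}
    (hψ : DifferentiableOn ℂ ψ W) {x : Fin m → ℂ} (hx : ∀ k, x k ∈ W) :
    ∃ H : Polynomial ℂ, H.degree < m ∧ ∃ η : ℂ → ℂ, DifferentiableOn ℂ η W ∧
      ∀ z, ψ z = H.eval z + (∏ k, (z - x k)) * η z := by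
  induction m with
  | zero => exact ⟨0, by simp, ψ, hψ, by simp⟩
  | succ m ih =>
    obtain ⟨H, hH, η, hη, h⟩ := ih (x := fun k => x k.succ) fun k => hx _
    refine ⟨H + Polynomial.C (η (x 0)) * ∏ k : Fin m, (Polynomial.X - Polynomial.C (x k.succ)),
      ?_, dslope η (x 0),
      (Complex.differentiableOn_dslope (hW.mem_nhds (hx 0))).2 hη, fun z => ?_⟩
    · refine (Polynomial.degree_add_le _ _).trans_lt (max_lt (hH.trans ?_) ?_)
      · exact_mod_cast m.lt_succ_self
      · rw [← Polynomial.smul_eq_C_mul]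
        refine (Polynomial.degree_smul_le _ _).trans_lt ?_
        rw [Polynomial.degree_prod]
        simp only [Polynomial.degree_X_sub_C, Finset.sum_const, Finset.card_univ, Fintype.card_fin,
          nsmul_eq_mul, mul_one]
        exact_mod_cast m.lt_succ_self
    · have h1 := sub_smul_dslope η (x 0) z
      rw [smul_eq_mul] at h1
      rw [h z, Fin.prod_univ_succ, Polynomial.eval_add, Polynomial.eval_mul, Polynomial.eval_C,
        Polynomial.eval_prod]
      simp only [Polynomial.eval_sub, Polynomial.eval_X, Polynomial.eval_C]
      linear_combination -(∏ k : Fin m, (z - x k.succ)) * h1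

/-- The power sums of `m` unordered complex numbers. -/
def psumFun {m : ℕ} (s : Sym ℂ m) : Fin m → ℂ := fun k => (s.1.map (· ^ (k.1 + 1))).sum

theorem exists_esymm_eq {m : ℕ} (k : ℕ) (hk : k ≤ m) : ∃ T : (Fin m → ℂ) → ℂ, ContDiff ℂ ω T ∧
    ∀ s : Sym ℂ m, s.1.esymm k = T (psumFun s) := by
  induction k using Nat.strong_induction_on with
  | _ k ih =>
    rcases Nat.eq_zero_or_pos k with rfl | hk0
    · exact ⟨fun _ => 1, contDiff_const, fun s => by simp [Multiset.esymm]⟩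
    choose! T hT hTs using fun p : ℕ × ℕ => ih p.1
    have hk1 : (k : ℂ) ≠ 0 := by exact_mod_cast hk0.ne'
    refine ⟨fun b => (k : ℂ)⁻¹ * ((-1) ^ (k + 1) *
      ∑ p ∈ Finset.HasAntidiagonal.antidiagonal k with p.1 < k,
        (-1) ^ p.1 * T p b * (if h : p.2 - 1 < m then b ⟨p.2 - 1, h⟩ else 0)), ?_, fun s => ?_⟩
    · refine contDiff_const.mul (contDiff_const.mul (ContDiff.sum fun p hp => ?_))
      have hp := (Finset.mem_filter.1 hp).2
      refine (contDiff_const.mul (hT p hp (by omega))).mul ?_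
      split_ifs
      · exact contDiff_apply ℂ ℂ _
      · exact contDiff_const
    · obtain ⟨x, rfl⟩ := ofTuple_surjective s
      have h := congrArg (MvPolynomial.aeval x) (MvPolynomial.mul_esymm_eq_sum (Fin m) ℂ k)
      simp only [map_mul, map_sum, map_pow, map_neg, map_one, map_natCast,
        MvPolynomial.aeval_esymm_eq_multiset_esymm, MvPolynomial.psum,
        MvPolynomial.aeval_X] at h
      change (Finset.univ.val.map x).esymm k = _
      rw [eq_inv_mul_iff_mul_eq₀ hk1, h]
      congr 1
      refine Finset.sum_congr rfl fun p hp => ?_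
      obtain ⟨hp1, hp2⟩ := Finset.mem_filter.1 hp
      have hp1 : p.1 + p.2 = k := Finset.HasAntidiagonal.mem_antidiagonal.1 hp1
      rw [dif_pos (by omega), ← hTs p hp2 (by omega)]
      congr 1
      simp only [psumFun]
      rw [sum_map_ofTuple, Nat.sub_add_cancel (by omega)]

/-- Newton's identities: the elementary symmetric functions are polynomials in the power sums. -/
theorem exists_esymmFun_eq (m : ℕ) : ∃ T : (Fin m → ℂ) → (Fin m → ℂ), ContDiff ℂ ω T ∧
    ∀ s : Sym ℂ m, esymmFun s = T (psumFun s) := by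
  choose T hT hTs using fun k : Fin m => exists_esymm_eq (m := m) (k.1 + 1) k.2
  exact ⟨fun b k => T k b, contDiff_pi.2 hT, fun s => funext fun k => hTs k s⟩

theorem contDiff_psumFun {m : ℕ} :
    ContDiff ℂ ω fun a : Fin m → ℂ => psumFun ((esymmHomeo m).symm a) := by
  refine contDiff_pi.2 fun k => ?_
  have h := contDiffOn_sum_map (m := m) isOpen_univ
    (ψ := fun z : ℂ => z ^ (k.1 + 1)) (by fun_prop)
  rw [← contDiffOn_univ]
  exact h.mono fun a _ r _ => Set.mem_univ r

/-- The power sums are local coordinates on the space of monic polynomials. -/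
theorem bijective_fderiv_psumFun {m : ℕ} (a : Fin m → ℂ) :
    Function.Bijective (fderiv ℂ (fun a : Fin m → ℂ => psumFun ((esymmHomeo m).symm a)) a) := by
  obtain ⟨T, hT, hTs⟩ := exists_esymmFun_eq m
  have hid : (fun a : Fin m → ℂ => T (psumFun ((esymmHomeo m).symm a))) = id := by
    funext a
    rw [← hTs, ← esymmHomeo_apply, Homeomorph.apply_symm_apply]
    rfl
  have h1 : (fderiv ℂ T (psumFun ((esymmHomeo m).symm a))).comp
      (fderiv ℂ (fun a : Fin m → ℂ => psumFun ((esymmHomeo m).symm a)) a) =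
      ContinuousLinearMap.id ℂ _ := by
    rw [← fderiv_id (x := a), ← hid]
    exact (fderiv_comp a (hT.differentiable (by simp) _)
      (contDiff_psumFun.differentiable (by simp) _)).symm
  have hinj : Function.Injective
      (fderiv ℂ (fun a : Fin m → ℂ => psumFun ((esymmHomeo m).symm a)) a) :=
    Function.LeftInverse.injective (g := fderiv ℂ T (psumFun ((esymmHomeo m).symm a)))
      fun v => DFunLike.congr_fun h1 v
  exact ⟨hinj, LinearMap.injective_iff_surjective.1 hinj⟩

/-- The cotangent space of `Sym^m` at the divisor `x₁ + ⋯ + x_m`: the differential of `∑ ψ (r)`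
vanishes if and only if the differential of `ψ` vanishes on the divisor. -/
theorem fderiv_sum_map_eq_zero_iff {m : ℕ} {W : Set ℂ} (hW : IsOpen W) {ψ : ℂ → ℂ}
    (hψ : DifferentiableOn ℂ ψ W) {x : Fin m → ℂ} (hx : ∀ k, x k ∈ W) :
    fderiv ℂ (fun a : Fin m → ℂ => (((esymmHomeo m).symm a).1.map ψ).sum)
      (esymmFun (ofTuple x)) = 0 ↔
      ∀ k, deriv ψ =O[𝓝 (x k)] fun z => ∏ j, (z - x j) := by
  have hat : ∀ k, ∀ᶠ z in 𝓝 (x k), z ∈ W := fun k => hW.mem_nhds (hx k)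
  constructor
  · intro h0
    obtain ⟨H, hH, η, hη, h⟩ := exists_polynomial_interpolation hW (hψ.deriv hW) hx
    have hηO : ∀ k, (fun z => (∏ j, (z - x j)) * η z) =O[𝓝 (x k)] fun z => ∏ j, (z - x j) := by
      intro k
      have h1 : ContinuousAt η (x k) := hη.continuousOn.continuousAt (hat k)
      simpa using (isBigO_refl (fun z => ∏ j, (z - x j)) (𝓝 (x k))).mul (h1.isBigO_one ℂ)
    -- a primitive `∑ c k * z ^ (k + 1)` of `H`
    let c : Fin m → ℂ := fun k => H.coeff k / (k + 1)
    let G : ℂ → ℂ := fun z => ∑ k : Fin m, c k * z ^ (k.1 + 1)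
    have hG : ∀ z, HasDerivAt G (H.eval z) z := by
      intro z
      have h1 : HasDerivAt G (∑ k : Fin m, c k * (((k.1 + 1 : ℕ) : ℂ) * z ^ k.1)) z :=
        HasDerivAt.fun_sum fun k _ => by
          simpa using (hasDerivAt_pow (k.1 + 1) z).const_mul (c k)
      convert h1 using 1
      rw [Polynomial.eval_eq_sum_degreeLTEquiv (Polynomial.mem_degreeLT.2 hH)]
      refine Finset.sum_congr rfl fun k _ => ?_
      have hk : ((k.1 : ℂ) + 1) ≠ 0 := Nat.cast_add_one_ne_zero k.1
      change H.coeff k * z ^ k.1 = _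
      simp only [c]
      push_cast
      field_simp
    have h1 : HasFDerivAt (fun a : Fin m → ℂ =>
        (((esymmHomeo m).symm a).1.map fun z => ψ z - G z).sum)
        (0 : (Fin m → ℂ) →L[ℂ] ℂ) (esymmFun (ofTuple x)) := by
      refine hasFDerivAt_sum_map_zero (fun k => (hat k).mono fun z hz =>
        (hψ.differentiableAt (hW.mem_nhds hz)).sub (hG z).differentiableAt) fun k => ?_
      refine (hηO k).congr' ((hat k).mono fun z hz => ?_) EventuallyEq.rfl
      rw [deriv_fun_sub (hψ.differentiableAt (hW.mem_nhds hz)) (hG z).differentiableAt,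
        (hG z).deriv, h z, add_sub_cancel_left]
    have h2 : HasFDerivAt (fun a : Fin m → ℂ => (((esymmHomeo m).symm a).1.map ψ).sum)
        (0 : (Fin m → ℂ) →L[ℂ] ℂ) (esymmFun (ofTuple x)) := by
      rw [← h0]
      refine DifferentiableAt.hasFDerivAt ?_
      refine ((contDiffOn_sum_map hW hψ).differentiableOn (by simp)).differentiableAt ?_
      refine ((isOpen_setOf_forall_mem hW).preimage (esymmHomeo m).symm.continuous).mem_nhds ?_
      intro r hr
      rw [symm_esymmFun_ofTuple] at hr
      obtain ⟨k, rfl⟩ := mem_ofTuple.1 hr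
      exact hx k
    let ℓ : (Fin m → ℂ) →L[ℂ] ℂ := ∑ k, c k • ContinuousLinearMap.proj k
    have hℓ : ∀ b, ℓ b = ∑ k, c k * b k := fun b => by simp [ℓ]
    let Ψ : (Fin m → ℂ) → (Fin m → ℂ) := fun a => psumFun ((esymmHomeo m).symm a)
    have h3 : HasFDerivAt (fun a => ℓ (Ψ a)) (0 : (Fin m → ℂ) →L[ℂ] ℂ)
        (esymmFun (ofTuple x)) := by
      have h4 := h2.sub h1
      rw [sub_zero] at h4
      refine h4.congr_of_eventuallyEq (Eventually.of_forall fun a => ?_)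
      obtain ⟨y, hy⟩ := ofTuple_surjective ((esymmHomeo m).symm a)
      simp only [Pi.sub_apply, hℓ, Ψ, ← hy, sum_map_ofTuple, psumFun, G]
      rw [← Finset.sum_sub_distrib]
      simp only [sub_sub_cancel, Finset.mul_sum]
      exact Finset.sum_comm
    have h5 : ℓ.comp (fderiv ℂ Ψ (esymmFun (ofTuple x))) = 0 :=
      (ℓ.hasFDerivAt.comp _ (contDiff_psumFun.differentiable (by simp) _).hasFDerivAt).unique h3
    have hc : ∀ k, c k = 0 := by
      intro k
      obtain ⟨v, hv⟩ := (bijective_fderiv_psumFun (esymmFun (ofTuple x))).2 (Pi.single k 1)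
      have h6 := DFunLike.congr_fun h5 v
      rw [ContinuousLinearMap.comp_apply, hv, hℓ] at h6
      simpa [Pi.single_apply] using h6
    have hH0 : H = 0 := by
      ext i
      by_cases hi : i < m
      · have h6 := hc ⟨i, hi⟩
        have hk : ((i : ℂ) + 1) ≠ 0 := Nat.cast_add_one_ne_zero i
        simpa [c, hk] using h6
      · rw [Polynomial.coeff_eq_zero_of_degree_lt (hH.trans_le (by exact_mod_cast not_lt.1 hi)),
          Polynomial.coeff_zero]
    intro k
    refine (hηO k).congr_left fun z => ?_
    rw [h z, hH0, Polynomial.eval_zero, zero_add]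
  · intro hO
    exact (hasFDerivAt_sum_map_zero
      (fun k => (hat k).mono fun z hz => hψ.differentiableAt (hW.mem_nhds hz)) hO).fderiv

end SymProd

namespace BranchedCover

open Polynomial Filter Asymptotics SymProd

/-! ### Odd differentials on the double cover modulo a divisor -/

/-- The operator `g ↦ Q' g / 2 + Q g'`. On the curve `y ^ 2 = Q(x)` one has
`d(y g(x)) = (Q' g / 2 + Q g')(x) dx / y`. -/
def oddDeriv (Q : ℂ[X]) : ℂ[X] →ₗ[ℂ] ℂ[X] where
  toFun g := C 2⁻¹ * derivative Q * g + Q * derivative g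
  map_add' g h := by
    simp only [derivative_add]
    ring
  map_smul' c g := by
    simp only [derivative_smul, RingHom.id_apply, mul_smul_comm, smul_add]

theorem oddDeriv_apply (Q g : ℂ[X]) :
    oddDeriv Q g = C 2⁻¹ * derivative Q * g + Q * derivative g := rfl

/-- Every odd differential `u dx / y` agrees with an exact one modulo a divisor which is disjoint
from the branch points. -/
theorem exists_dvd_oddDeriv_sub (Q : ℂ[X]) (s : Multiset ℂ) (hs : ∀ r ∈ s, Q.eval r ≠ 0)
    (u : ℂ[X]) : ∃ g, (s.map fun r => X - C r).prod ∣ oddDeriv Q g - u := by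
  induction s using Multiset.induction_on with
  | empty => exact ⟨0, by simp⟩
  | cons r s ih =>
    obtain ⟨g, q, hq⟩ := ih fun t ht => hs t (Multiset.mem_cons_of_mem ht)
    set P := (s.map fun r => X - C r).prod with hP
    have hP0 : P ≠ 0 := (monic_multiset_prod_of_monic s _ fun t _ => monic_X_sub_C t).ne_zero
    obtain ⟨P₂, hP₂, hnd⟩ := exists_eq_pow_rootMultiplicity_mul_and_not_dvd P hP0 r
    set k := rootMultiplicity r P
    have hr : P₂.eval r ≠ 0 := fun h => hnd (dvd_iff_isRoot.2 h)
    have hQ : Q.eval r ≠ 0 := hs r (Multiset.mem_cons_self r s)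
    have hk : ((k : ℂ) + 1) ≠ 0 := Nat.cast_add_one_ne_zero k
    -- add a multiple of `(X - r) ^ (k + 1) * P₂ ^ 2`, which `oddDeriv` sends to
    -- a multiple of `P` whose quotient by `P` does not vanish at `r`
    let c : ℂ := -q.eval r / ((k + 1) * Q.eval r * P₂.eval r)
    let v : ℂ[X] := C c * ((k + 1 : ℂ[X]) * Q * P₂ +
      (X - C r) * (C 2⁻¹ * derivative Q * P₂ + 2 * Q * derivative P₂))
    have hv : oddDeriv Q (C c * ((X - C r) ^ (k + 1) * P₂ ^ 2)) = P * v := by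
      rw [oddDeriv_apply, hP₂]
      simp only [v, derivative_mul, derivative_C, derivative_pow, derivative_sub, derivative_X]
      push_cast
      have h2 : (C (2 : ℂ) : ℂ[X]) = 2 := rfl
      simp only [zero_mul, map_add, map_natCast, map_one, sub_zero, mul_one, h2, pow_one, zero_add]
      ring
    have hroot : (X - C r) ∣ q + v := by
      rw [dvd_iff_isRoot, IsRoot]
      simp only [v, c, eval_add, eval_mul, eval_C, eval_natCast, eval_one, eval_sub, eval_X,
        sub_self, zero_mul, add_zero]
      field_simp
      ring
    obtain ⟨t, ht⟩ := hroot
    refine ⟨g + C c * ((X - C r) ^ (k + 1) * P₂ ^ 2), t, ?_⟩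
    rw [map_add, hv, Multiset.map_cons, Multiset.prod_cons, ← hP]
    linear_combination hq + P * ht

/-- A polynomial vanishing at least as fast as `∏ (z - r)` at each `r ∈ s` is divisible by
`∏ (X - r)`. -/
theorem prod_dvd_of_isBigO (s : Multiset ℂ) (u : ℂ[X])
    (h : ∀ r ∈ s, (fun z => u.eval z) =O[𝓝[≠] r] fun z => (s.map fun r => X - C r).prod.eval z) :
    (s.map fun r => X - C r).prod ∣ u := by
  induction s using Multiset.induction_on generalizing u with
  | empty => simp
  | cons r s ih =>
    simp only [Multiset.map_cons, Multiset.prod_cons] at h ⊢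
    set P := (s.map fun r => X - C r).prod
    have hu : u.eval r = 0 := by
      have h1 : Tendsto (fun z => ((X - C r) * P).eval z) (𝓝[≠] r) (𝓝 0) := by
        have := (((X - C r) * P).continuous.tendsto r).mono_left
          (nhdsWithin_le_nhds (s := {r}ᶜ))
        simpa using this
      have h2 := (h r (Multiset.mem_cons_self r s)).trans_tendsto h1
      exact tendsto_nhds_unique ((u.continuous.tendsto r).mono_left nhdsWithin_le_nhds) h2
    obtain ⟨u', rfl⟩ := dvd_iff_isRoot.2 hu
    refine mul_dvd_mul_left _ (ih u' fun t ht => ?_)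
    have h1 := h t (Multiset.mem_cons_of_mem ht)
    simp only [eval_mul] at h1
    have hne : ∀ᶠ z in 𝓝[≠] t, (X - C r).eval z ≠ 0 := by
      simp only [eval_sub, eval_X, eval_C]
      by_cases hrt : t = r
      · subst hrt
        filter_upwards [self_mem_nhdsWithin] with z hz
        exact sub_ne_zero.2 hz
      · refine nhdsWithin_le_nhds ?_
        have : ContinuousAt (fun z : ℂ => z - r) t := by fun_prop
        exact this.eventually_ne (sub_ne_zero.2 hrt)
    have h2 := (isBigO_refl (fun z => ((X - C r).eval z)⁻¹) (𝓝[≠] t)).mul h1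
    refine h2.congr' ?_ ?_ <;> filter_upwards [hne] with z hz <;> field_simp

theorem monicPoly_degree {m : ℕ} (a : Fin m → ℂ) : (monicPoly a).degree = m := by
  rw [degree_eq_natDegree (monicPoly_monic a).ne_zero, monicPoly_natDegree]

theorem continuous_coeff_monicPoly {m : ℕ} (k : ℕ) :
    Continuous fun a : Fin m → ℂ => (monicPoly a).coeff k :=
  (contDiff_linear_monicPoly (Polynomial.lcoeff ℂ k)).continuous

/-- The remainder of a fixed polynomial modulo a monic polynomial depends continuously on the
latter. -/
theorem continuous_coeff_modByMonic {m : ℕ} (u : ℂ[X]) (k : ℕ) :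
    Continuous fun a : Fin m → ℂ => (u %ₘ monicPoly a).coeff k := by
  rcases Nat.eq_zero_or_pos m with rfl | hm
  · exact continuous_of_const fun a b => by rw [Subsingleton.elim a b]
  induction u using Polynomial.induction_on' generalizing k with
  | add p q hp hq =>
    simp only [add_modByMonic, coeff_add]
    exact (hp k).add (hq k)
  | monomial i c =>
    simp only [← smul_X_eq_monomial, smul_modByMonic, coeff_smul]
    refine Continuous.const_smul ?_ c
    induction i generalizing k with
    | zero =>
      have h : ∀ a : Fin m → ℂ, (X ^ 0 : ℂ[X]) %ₘ monicPoly a = 1 := fun a => by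
        rw [pow_zero, modByMonic_eq_self_iff (monicPoly_monic a), monicPoly_degree, degree_one]
        exact_mod_cast hm
      simp only [h]
      exact continuous_const
    | succ i ih =>
      have h : ∀ a : Fin m → ℂ, (X ^ (i + 1) : ℂ[X]) %ₘ monicPoly a =
          X * (X ^ i %ₘ monicPoly a) -
            C ((X ^ i %ₘ monicPoly a).coeff (m - 1)) * monicPoly a := by
        intro a
        set r := X ^ i %ₘ monicPoly a with hr
        have hrd : r.degree < m := by
          rw [← monicPoly_degree a]
          exact degree_modByMonic_lt _ (monicPoly_monic a)
        refine ((div_modByMonic_unique (X * (X ^ i /ₘ monicPoly a) + C (r.coeff (m - 1))) _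
          (monicPoly_monic a) ⟨?_, ?_⟩)).2
        · have := modByMonic_add_div (X ^ i : ℂ[X]) (monicPoly a)
          rw [← hr] at this
          rw [pow_succ]
          linear_combination X * this
        · rw [monicPoly_degree, degree_lt_iff_coeff_zero]
          intro j hj
          obtain ⟨j, rfl⟩ : ∃ i, j = i + 1 := ⟨j - 1, by omega⟩
          rw [coeff_sub, coeff_X_mul, coeff_C_mul]
          rcases eq_or_lt_of_le hj with hj | hj
          · have h1 : (monicPoly a).coeff (j + 1) = 1 := by
              have h2 := (monicPoly_monic a).coeff_natDegree
              rw [monicPoly_natDegree] at h2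
              exact (congrArg (monicPoly a).coeff hj).symm.trans h2
            rw [h1, hj, Nat.add_sub_cancel, mul_one, sub_self]
          · rw [coeff_eq_zero_of_degree_lt (hrd.trans_le (by exact_mod_cast (by omega : m ≤ j))),
              coeff_eq_zero_of_degree_lt (p := monicPoly a)
                (by rw [monicPoly_degree]; exact_mod_cast hj)]
            simp
      simp only [h, coeff_sub, coeff_C_mul]
      refine Continuous.sub ?_ ((ih _).mul (continuous_coeff_monicPoly k))
      cases k with
      | zero => simpa using continuous_const
      | succ k => simpa only [coeff_X_mul] using ih k

/-- The polynomial of degree less than `N` with given coefficients. -/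
def polyOfCoeffs {N : ℕ} (b : Fin N → ℂ) : ℂ[X] := ∑ i, b i • (X : ℂ[X]) ^ i.1

theorem exists_polyOfCoeffs {N : ℕ} {g : ℂ[X]} (hg : g.degree < N) :
    ∃ b : Fin N → ℂ, polyOfCoeffs b = g := by
  refine ⟨fun i => g.coeff i, ?_⟩
  ext k
  simp only [polyOfCoeffs, finsetSum_coeff, coeff_smul, coeff_X_pow, smul_eq_mul, mul_ite, mul_one,
    mul_zero]
  by_cases hk : k < N
  · rw [Finset.sum_eq_single ⟨k, hk⟩] <;> simp +contextual [Fin.ext_iff, eq_comm]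
  · rw [coeff_eq_zero_of_degree_lt (hg.trans_le (by exact_mod_cast not_lt.1 hk))]
    refine Finset.sum_eq_zero fun i _ => if_neg ?_
    have := i.2
    omega

/-- The matrix of `g ↦ oddDeriv Q g` modulo `monicPoly a`, on polynomials `g` of degree less
than `2 * m`. -/
def oddMatrix (Q : ℂ[X]) {m : ℕ} (a : Fin m → ℂ) : Matrix (Fin m) (Fin (2 * m)) ℂ :=
  fun j i => (oddDeriv Q (X ^ i.1) %ₘ monicPoly a).coeff j

theorem continuous_oddMatrix (Q : ℂ[X]) {m : ℕ} :
    Continuous (oddMatrix Q : (Fin m → ℂ) → _) :=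
  continuous_pi fun _ => continuous_pi fun _ => continuous_coeff_modByMonic _ _

theorem oddMatrix_mulVec (Q : ℂ[X]) {m : ℕ} (a : Fin m → ℂ) (b : Fin (2 * m) → ℂ) (j : Fin m) :
    (oddMatrix Q a).mulVec b j = (oddDeriv Q (polyOfCoeffs b) %ₘ monicPoly a).coeff j := by
  have h := map_sum ((lcoeff ℂ j.1) ∘ₗ (modByMonicHom (monicPoly a)) ∘ₗ oddDeriv Q)
    (fun i : Fin (2 * m) => b i • (X : ℂ[X]) ^ i.1) Finset.univ
  simp only [map_smul] at h
  refine Eq.trans ?_ h.symm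
  simp only [Matrix.mulVec, dotProduct, smul_eq_mul]
  exact Finset.sum_congr rfl fun i _ => mul_comm _ _

theorem oddMatrix_mulVec_eq_zero_iff (Q : ℂ[X]) {m : ℕ} (a : Fin m → ℂ) (b : Fin (2 * m) → ℂ) :
    (oddMatrix Q a).mulVec b = 0 ↔ monicPoly a ∣ oddDeriv Q (polyOfCoeffs b) := by
  rw [← modByMonic_eq_zero_iff_dvd (monicPoly_monic a)]
  constructor
  · intro h
    ext j
    by_cases hj : j < m
    · have := congrFun h ⟨j, hj⟩
      rwa [oddMatrix_mulVec] at this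
    · refine coeff_eq_zero_of_degree_lt ((degree_modByMonic_lt _ (monicPoly_monic a)).trans_le ?_)
      rw [monicPoly_degree]
      exact_mod_cast not_lt.1 hj
  · intro h
    ext j
    rw [oddMatrix_mulVec, h]
    rfl

theorem oddMatrix_surjective (Q : ℂ[X]) {m : ℕ} (x : Fin m → ℂ) (hx : ∀ k, Q.eval (x k) ≠ 0) :
    Function.Surjective (oddMatrix Q (esymmFun (ofTuple x))).mulVec := by
  intro c
  set P := monicPoly (esymmFun (ofTuple x)) with hP
  have hPm : P.Monic := monicPoly_monic _
  obtain ⟨g, hg⟩ := exists_dvd_oddDeriv_sub Q (ofTuple x).1 (fun r hr => by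
    obtain ⟨k, rfl⟩ := mem_ofTuple.1 hr
    exact hx k) (polyOfCoeffs c)
  rw [← monicPoly_esymmFun, ← hP] at hg
  -- `oddDeriv` of a multiple of `P ^ 2` is a multiple of `P`
  have hsq : ∀ h, P ∣ oddDeriv Q (P ^ 2 * h) := fun h =>
    ⟨C 2⁻¹ * derivative Q * P * h + Q * (2 * derivative P * h + P * derivative h), by
      rw [oddDeriv_apply]
      simp only [derivative_mul, derivative_pow, Nat.cast_ofNat, Nat.add_one_sub_one, pow_one]
      have : (C (2 : ℂ) : ℂ[X]) = 2 := rfl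
      rw [this]
      ring⟩
  obtain ⟨b, hb⟩ := exists_polyOfCoeffs (N := 2 * m) (g := g %ₘ P ^ 2) (by
    refine (degree_modByMonic_lt _ (hPm.pow 2)).trans_le ?_
    rw [degree_pow, monicPoly_degree]
    simp)
  refine ⟨b, funext fun j => ?_⟩
  rw [oddMatrix_mulVec, hb, ← hP]
  have h1 : P ∣ oddDeriv Q (g %ₘ P ^ 2) - polyOfCoeffs c := by
    have h2 := dvd_sub hg (hsq (g /ₘ P ^ 2))
    have h3 : g %ₘ P ^ 2 = g - P ^ 2 * (g /ₘ P ^ 2) := by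
      rw [eq_sub_iff_add_eq, modByMonic_add_div]
    rw [h3, map_sub]
    rwa [sub_right_comm]
  rw [← modByMonic_eq_zero_iff_dvd hPm, sub_modByMonic, sub_eq_zero] at h1
  have h4 : ∀ k, (polyOfCoeffs c).coeff k = if h : k < m then c ⟨k, h⟩ else 0 := by
    intro k
    simp only [polyOfCoeffs, finsetSum_coeff, coeff_smul, coeff_X_pow, smul_eq_mul, mul_ite,
      mul_one, mul_zero]
    split_ifs with hk
    · rw [Finset.sum_eq_single ⟨k, hk⟩] <;> simp +contextual [Fin.ext_iff, eq_comm]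
    · refine Finset.sum_eq_zero fun i _ => if_neg ?_
      have := i.2
      omega
  rw [h1, (modByMonic_eq_self_iff hPm).2, h4, dif_pos j.2]
  rw [monicPoly_degree, degree_lt_iff_coeff_zero]
  intro k hk
  rw [h4, dif_neg (not_lt.2 hk)]

open scoped ComplexOrder in
/-- A continuous family of surjective matrices has a continuous family of right inverses. -/
theorem exists_continuous_rightInverse {Y : Type*} [TopologicalSpace Y] {m N : ℕ}
    {A : Y → Matrix (Fin m) (Fin N) ℂ} (hA : Continuous A)
    (hs : ∀ y, Function.Surjective (A y).mulVec) :
    ∃ R : Y → Matrix (Fin N) (Fin m) ℂ, Continuous R ∧ ∀ y, A y * R y = 1 := by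
  have hdet : ∀ y, (A y * (A y).conjTranspose).det ≠ 0 := by
    intro y
    refine ne_of_gt (Matrix.PosDef.det_pos (Matrix.PosDef.mul_conjTranspose_self _ ?_))
    intro v w hvw
    refine dotProduct_eq _ _ fun c => ?_
    obtain ⟨b, rfl⟩ := hs y c
    rw [Matrix.dotProduct_mulVec, Matrix.dotProduct_mulVec]
    exact congrArg (· ⬝ᵥ b) hvw
  refine ⟨fun y => (A y).conjTranspose * (A y * (A y).conjTranspose)⁻¹, ?_, fun y => ?_⟩
  · have hB : Continuous fun y => A y * (A y).conjTranspose :=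
      hA.matrix_mul hA.matrix_conjTranspose
    refine hA.matrix_conjTranspose.matrix_mul ?_
    simp only [Matrix.inv_def, Ring.inverse_eq_inv']
    exact (hB.matrix_det.inv₀ hdet).smul hB.matrix_adjugate
  · rw [← Matrix.mul_assoc]
    exact Matrix.mul_nonsing_inv _ (isUnit_iff_ne_zero.2 (hdet y))

end BranchedCover

namespace SymProd

open Filter Asymptotics

/-! ### Traces of functions on symmetric products of Riemann surfaces -/

/-- The sum of the values of `ψ` over an unordered tuple. -/
def traceFun {X : Type*} {m : ℕ} (ψ : X → ℂ) (s : Sym X m) : ℂ := (s.1.map ψ).sum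

theorem traceFun_ofTuple {X : Type*} {m : ℕ} (ψ : X → ℂ) (x : Fin m → X) :
    traceFun ψ (ofTuple x) = ∑ k, ψ (x k) := sum_map_ofTuple ψ x

section Charts

variable {X : Type*} [TopologicalSpace X] {m : ℕ}

theorem symChart_apply (g : OpenPartialHomeomorph X ℂ) (s : Sym X m) :
    symChart m g s = esymmFun (Sym.map g s) := rfl

theorem symChart_ofTuple (g : OpenPartialHomeomorph X ℂ) (x : Fin m → X) :
    symChart m g (ofTuple x) = esymmFun (ofTuple fun k => g (x k)) := by
  rw [symChart_apply, map_ofTuple]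
  rfl

theorem traceFun_symChart_symm (g : OpenPartialHomeomorph X ℂ) (ψ : X → ℂ) (a : Fin m → ℂ) :
    traceFun ψ ((symChart m g).symm a) =
      (((esymmHomeo m).symm a).1.map fun z => ψ (g.symm z)).sum :=
  congrArg Multiset.sum (Multiset.map_map ψ g.symm ((esymmHomeo m).symm a).1)

/-- Near a point of the domain of `symChart m g`, the trace of `ψ` is the sum of `ψ ∘ g.symm` over
the roots of the polynomial given by the chart. -/
theorem traceFun_eventuallyEq {g : OpenPartialHomeomorph X ℂ} (ψ : X → ℂ) {s : Sym X m}
    (hs : s ∈ (symChart m g).source) :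
    traceFun ψ =ᶠ[𝓝 s] (fun a : Fin m → ℂ =>
      (((esymmHomeo m).symm a).1.map fun z => ψ (g.symm z)).sum) ∘ symChart m g := by
  filter_upwards [(symChart m g).open_source.mem_nhds hs] with t ht
  rw [Function.comp_apply, ← traceFun_symChart_symm, (symChart m g).left_inv ht]

end Charts

variable {X : Type*} [TopologicalSpace X] [ChartedSpace ℂ X] [IsManifold 𝓘(ℂ) ω X] [T2Space X]
  [Nonempty X] {m : ℕ}

theorem symChart_mem_atlas {g : OpenPartialHomeomorph X ℂ} (hg : IsHolChart g) :
    symChart m g ∈ atlas (Fin m → ℂ) (Sym X m) := ⟨g, hg, rfl⟩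

/-- The trace of a holomorphic function is holomorphic. -/
theorem contMDiffAt_traceFun {U : Set X} (hU : IsOpen U) {ψ : X → ℂ}
    (hψ : ContMDiffOn 𝓘(ℂ) 𝓘(ℂ) ω ψ U) {s : Sym X m} (hs : ∀ p ∈ s, p ∈ U) :
    ContMDiffAt 𝓘(ℂ, Fin m → ℂ) 𝓘(ℂ) ω (traceFun ψ) s := by
  obtain ⟨g, hg, hsg⟩ := exists_isHolChart_sym s
  let W : Set ℂ := g.target ∩ g.symm ⁻¹' U
  have hW : IsOpen W := g.isOpen_inter_preimage_symm hU
  have hφ : DifferentiableOn ℂ (fun z => ψ (g.symm z)) W := by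
    have h : ContMDiffOn 𝓘(ℂ) 𝓘(ℂ) ω (ψ ∘ g.symm) W :=
      hψ.comp (hg.2.mono Set.inter_subset_left) fun z hz => hz.2
    exact h.contDiffOn.differentiableOn (by simp)
  have hL := contDiffOn_sum_map (m := m) hW hφ
  have hmem : {a : Fin m → ℂ | ∀ r ∈ (esymmHomeo m).symm a, r ∈ W} ∈ 𝓝 (symChart m g s) := by
    refine ((isOpen_setOf_forall_mem hW).preimage (esymmHomeo m).symm.continuous).mem_nhds ?_
    change ∀ r ∈ (esymmHomeo m).symm (esymmHomeo m (Sym.map g s)), r ∈ W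
    rw [Homeomorph.symm_apply_apply]
    intro r hr
    obtain ⟨p, hp, rfl⟩ := Sym.mem_map.1 hr
    refine ⟨g.map_source (hsg p hp), ?_⟩
    rw [Set.mem_preimage, g.left_inv (hsg p hp)]
    exact hs p hp
  refine ContMDiffAt.congr_of_eventuallyEq ?_ (traceFun_eventuallyEq ψ hsg)
  exact ((hL.contDiffAt hmem).contMDiffAt).comp s
    (contMDiffAt_of_mem_maximalAtlas
      (IsManifold.subset_maximalAtlas (symChart_mem_atlas hg)) hsg)

/-- The differential of the trace of `ψ` at `x₁ ⋯ x_m` vanishes if and only if the differential of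
`ψ` vanishes on the divisor `x₁ + ⋯ + x_m`. -/
theorem mfderiv_traceFun_eq_zero_iff {g : OpenPartialHomeomorph X ℂ} (hg : IsHolChart g)
    {ψ : X → ℂ} (hψ : ContMDiff 𝓘(ℂ) 𝓘(ℂ) ω ψ) {x : Fin m → X} (hx : ∀ k, x k ∈ g.source) :
    (∀ v, mfderiv 𝓘(ℂ, Fin m → ℂ) 𝓘(ℂ) (traceFun ψ) (ofTuple x) v = (0 : ℂ)) ↔
      ∀ k, deriv (fun z => ψ (g.symm z)) =O[𝓝 (g (x k))] fun z => ∏ j, (z - g (x j)) := by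
  have hφ : DifferentiableOn ℂ (fun z => ψ (g.symm z)) g.target := by
    have h : ContMDiffOn 𝓘(ℂ) 𝓘(ℂ) ω (ψ ∘ g.symm) g.target :=
      hψ.comp_contMDiffOn hg.2
    exact h.contDiffOn.differentiableOn (by simp)
  have hs : ofTuple x ∈ (symChart m g).source := by
    intro p hp
    obtain ⟨k, rfl⟩ := mem_ofTuple.1 hp
    exact hx k
  have hgx : ∀ k, g (x k) ∈ g.target := fun k => g.map_source (hx k)
  rw [← fderiv_sum_map_eq_zero_iff g.open_target hφ hgx]
  have he := mdifferentiable_of_mem_atlas (I := 𝓘(ℂ, Fin m → ℂ)) (symChart_mem_atlas (m := m) hg)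
  have hL : DifferentiableAt ℂ (fun a : Fin m → ℂ =>
      (((esymmHomeo m).symm a).1.map fun z => ψ (g.symm z)).sum) (symChart m g (ofTuple x)) := by
    have hmem : (symChart m g).target ∈ 𝓝 (symChart m g (ofTuple x)) :=
      (symChart m g).open_target.mem_nhds ((symChart m g).map_source hs)
    exact ((contDiffOn_sum_map g.open_target hφ).differentiableOn (by simp)).differentiableAt hmem
  rw [(traceFun_eventuallyEq ψ hs).mfderiv_eq,
    mfderiv_comp _ hL.mdifferentiableAt (he.mdifferentiableAt hs), mfderiv_eq_fderiv,
    symChart_ofTuple]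
  constructor
  · intro h
    ext1 w
    obtain ⟨v, rfl⟩ := he.mfderiv_surjective hs w
    exact h v
  · intro h v
    rw [h]
    rfl

/-- A map to a symmetric product is differentiable if the traces of the powers of a local coordinate
are differentiable along it. -/
theorem mdifferentiableAt_of_traceFun {E H N : Type*} [NormedAddCommGroup E] [NormedSpace ℂ E]
    [TopologicalSpace H] {I : ModelWithCorners ℂ E H} [TopologicalSpace N] [ChartedSpace H N]
    {g : OpenPartialHomeomorph X ℂ} (hg : IsHolChart g) {f : N → Sym X m} {p : N}
    (hf : ∀ᶠ q in 𝓝 p, f q ∈ (symChart m g).source)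
    (hd : ∀ k : Fin m,
      ContMDiffAt I 𝓘(ℂ) ω (fun q => traceFun (fun y => g y ^ (k.1 + 1)) (f q)) p) :
    MDifferentiableAt I 𝓘(ℂ, Fin m → ℂ) f p := by
  obtain ⟨T, hT, hTs⟩ := exists_esymmFun_eq m
  let b : N → (Fin m → ℂ) := fun q k => traceFun (fun y => g y ^ (k.1 + 1)) (f q)
  have hb : ∀ q, symChart m g (f q) = T (b q) := by
    intro q
    rw [symChart_apply, hTs]
    congr 1
    ext k
    exact congrArg Multiset.sum (Multiset.map_map _ _ _)
  have hbd : MDifferentiableAt I 𝓘(ℂ, Fin m → ℂ) b p := 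
    (contMDiffAt_pi_space.2 hd).mdifferentiableAt (by simp)
  have hfp := mem_of_mem_nhds hf
  have h1 : MDifferentiableAt I 𝓘(ℂ, Fin m → ℂ) ((symChart m g).symm ∘ T ∘ b) p := by
    refine MDifferentiableAt.comp (I' := 𝓘(ℂ, Fin m → ℂ)) p ?_ ?_
    · refine mdifferentiableAt_atlas_symm (symChart_mem_atlas hg) ?_
      rw [Function.comp_apply, ← hb]
      exact (symChart m g).map_source hfp
    · exact (hT.differentiable (by simp) _).mdifferentiableAt.comp p hbd
  refine h1.congr_of_eventuallyEq ?_
  filter_upwards [hf] with q hq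
  rw [Function.comp_apply, Function.comp_apply, ← hb, (symChart m g).left_inv hq]

/-- The traces of the powers of a coordinate separate tangent vectors. -/
theorem eq_zero_of_mfderiv_traceFun_pow {g : OpenPartialHomeomorph X ℂ} (hg : IsHolChart g)
    {s : Sym X m} (hs : s ∈ (symChart m g).source)
    (v : TangentSpace 𝓘(ℂ, Fin m → ℂ) s)
    (hv : mfderiv 𝓘(ℂ, Fin m → ℂ) 𝓘(ℂ, Fin m → ℂ)
      (fun s (k : Fin m) => traceFun (fun y => g y ^ (k.1 + 1)) s) s v = (0 : Fin m → ℂ)) :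
    v = 0 := by
  have he := mdifferentiable_of_mem_atlas (I := 𝓘(ℂ, Fin m → ℂ)) (symChart_mem_atlas (m := m) hg)
  let Ψ : (Fin m → ℂ) → (Fin m → ℂ) := fun a => psumFun ((esymmHomeo m).symm a)
  have h1 : (fun s (k : Fin m) => traceFun (fun y => g y ^ (k.1 + 1)) s) = Ψ ∘ symChart m g := by
    funext s k
    change _ = psumFun ((esymmHomeo m).symm (esymmHomeo m (Sym.map g s))) k
    rw [Homeomorph.symm_apply_apply]
    exact (congrArg Multiset.sum (Multiset.map_map (· ^ (k.1 + 1)) g s.1)).symm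
  rw [h1, mfderiv_comp s
    ((contDiff_psumFun (m := m)).differentiable (by simp) _).mdifferentiableAt (he.mdifferentiableAt hs),
    mfderiv_eq_fderiv] at hv
  have h2 : mfderiv 𝓘(ℂ, Fin m → ℂ) 𝓘(ℂ, Fin m → ℂ) (symChart m g) s v = (0 : Fin m → ℂ) :=
    (injective_iff_map_eq_zero _).1 (bijective_fderiv_psumFun (symChart m g s)).1 _ hv
  exact (injective_iff_map_eq_zero _).1 (he.mfderiv_injective hs) v h2

end SymProd

namespace BranchedCover

open Filter Asymptotics SymProd

variable {B : Finset ℂ}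

/-! ### Holomorphic functions on the double cover -/

theorem sheetChart_apply (q₀ q : DoubleCover B) : sheetChart q₀ q = q.x := rfl

theorem mem_source_sheetChart (q : DoubleCover B) : q ∈ (sheetChart q).source :=
  mem_chart_source ℂ q

theorem isHolChart_sheetChart (q : DoubleCover B) : IsHolChart (sheetChart q) :=
  isHolChart_chartAt q

theorem sheetChart_symm_x (q₀ : DoubleCover B) {z : ℂ} (hz : z ∈ (sheetChart q₀).target) :
    ((sheetChart q₀).symm z).x = z := (sheetChart q₀).right_inv hz

theorem contMDiff_x : ContMDiff 𝓘(ℂ) 𝓘(ℂ) ω (DoubleCover.x : DoubleCover B → ℂ) := fun q =>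
  ((isHolChart_sheetChart q).1.contMDiffAt
    ((sheetChart q).open_source.mem_nhds (mem_source_sheetChart q)))

theorem contMDiff_y : ContMDiff 𝓘(ℂ) 𝓘(ℂ) ω (DoubleCover.y : DoubleCover B → ℂ) := by
  intro q
  let φ : ℂ → ℂ := fun z => q.y * ((∏ b ∈ B, (z - b)) / q.y ^ 2) ^ (2⁻¹ : ℂ)
  have hφ : DifferentiableOn ℂ φ (sheetChart q).target := by
    intro z hz
    refine DifferentiableAt.differentiableWithinAt ?_
    have hu : DifferentiableAt ℂ (fun z => (∏ b ∈ B, (z - b)) / q.y ^ 2) z := by fun_prop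
    exact (hu.cpow_const hz.2).const_mul q.y
  have hq := mem_source_sheetChart q
  have h1 : ContMDiffAt 𝓘(ℂ) 𝓘(ℂ) ω (φ ∘ sheetChart q) q := by
    refine ContMDiffAt.comp q (ContDiffAt.contMDiffAt ?_) (contMDiff_x q)
    exact (hφ.contDiffOn (sheetChart q).open_target).contDiffAt
      ((sheetChart q).open_target.mem_nhds ((sheetChart q).map_source hq))
  refine h1.congr_of_eventuallyEq ?_
  filter_upwards [(sheetChart q).open_source.mem_nhds hq] with p hp
  have h2 := congrArg DoubleCover.y ((sheetChart q).left_inv hp)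
  rw [← h2]
  have h3 : (sheetChart q p) ∉ B := p.notMem
  change (dite (sheetChart q p ∉ B) _ _ : DoubleCover B).y = _
  rw [dif_pos h3]
  rfl

theorem eq_or_eq_tau {q q' : DoubleCover B} (h : q.x = q'.x) : q = q' ∨ q = tau q' := by
  have h1 : q.y ^ 2 = q'.y ^ 2 := by rw [q.sq_eq, q'.sq_eq, h]
  rcases sq_eq_sq_iff_eq_or_eq_neg.1 h1 with h2 | h2
  · exact Or.inl (DoubleCover.ext h h2)
  · exact Or.inr (DoubleCover.ext h h2)

theorem tau_tau (q : DoubleCover B) : tau (tau q) = q :=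
  DoubleCover.ext rfl (neg_neg q.y)

theorem ne_tau (q : DoubleCover B) : q ≠ tau q := by
  intro h
  have h1 : q.y = -q.y := congrArg DoubleCover.y h
  exact y_ne_zero q (self_eq_neg.1 h1)

theorem isTheta_one_of_ne {f : ℂ → ℂ} {z : ℂ} (hf : ContinuousAt f z) (h0 : f z ≠ 0) :
    f =Θ[𝓝 z] fun _ => (1 : ℂ) := by
  refine ⟨hf.isBigO_one ℂ, (isBigO_const_left_iff_pos_le_norm one_ne_zero).2
    ⟨‖f z‖ / 2, by positivity, ?_⟩⟩
  have h1 : ‖f z‖ / 2 < ‖f z‖ := half_lt_self (norm_pos_iff.2 h0)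
  exact (hf.norm.eventually_const_lt h1).mono fun _ h => h.le

section Chart

variable {g : OpenPartialHomeomorph (DoubleCover B) ℂ}

theorem differentiableAt_x_symm (hg : IsHolChart g) {z : ℂ} (hz : z ∈ g.target) :
    DifferentiableAt ℂ (fun z => (g.symm z).x) z := by
  have h : ContMDiffOn 𝓘(ℂ) 𝓘(ℂ) ω (DoubleCover.x ∘ g.symm) g.target :=
    contMDiff_x.comp_contMDiffOn hg.2
  exact (h.contDiffOn.differentiableOn (by simp)).differentiableAt (g.open_target.mem_nhds hz)

theorem differentiableAt_y_symm (hg : IsHolChart g) {z : ℂ} (hz : z ∈ g.target) :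
    DifferentiableAt ℂ (fun z => (g.symm z).y) z := by
  have h : ContMDiffOn 𝓘(ℂ) 𝓘(ℂ) ω (DoubleCover.y ∘ g.symm) g.target :=
    contMDiff_y.comp_contMDiffOn hg.2
  exact (h.contDiffOn.differentiableOn (by simp)).differentiableAt (g.open_target.mem_nhds hz)

theorem deriv_x_symm_ne_zero (hg : IsHolChart g) {z : ℂ} (hz : z ∈ g.target) :
    deriv (fun z => (g.symm z).x) z ≠ 0 := by
  set q := g.symm z with hq
  have hqs := mem_source_sheetChart q
  have hgs : ContMDiffAt 𝓘(ℂ) 𝓘(ℂ) ω (g ∘ (sheetChart q).symm) q.x := by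
    have h1 : (sheetChart q).symm q.x = q := (sheetChart q).left_inv hqs
    refine ContMDiffAt.comp (I' := 𝓘(ℂ)) _ ?_ ?_
    · rw [h1]
      exact hg.1.contMDiffAt (g.open_source.mem_nhds (g.map_target hz))
    · exact (isHolChart_sheetChart q).2.contMDiffAt
        ((sheetChart q).open_target.mem_nhds ((sheetChart q).map_source hqs))
  have h2 : HasDerivAt (g ∘ (sheetChart q).symm) (deriv (g ∘ (sheetChart q).symm) q.x) q.x :=
    (hgs.contDiffAt.differentiableAt (by simp)).hasDerivAt
  have h3 := h2.comp z (differentiableAt_x_symm hg hz).hasDerivAt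
  have h4 : (g ∘ (sheetChart q).symm) ∘ (fun z => (g.symm z).x) =ᶠ[𝓝 z] id := by
    have hc : ∀ᶠ w in 𝓝 z, g.symm w ∈ (sheetChart q).source :=
      (g.continuousAt_symm hz).eventually ((sheetChart q).open_source.mem_nhds hqs)
    filter_upwards [hc, g.open_target.mem_nhds hz] with w hw hwt
    change g ((sheetChart q).symm (sheetChart q (g.symm w))) = w
    rw [(sheetChart q).left_inv hw, g.right_inv hwt]
  have h5 := (h3.congr_of_eventuallyEq h4.symm).unique (hasDerivAt_id z)
  exact right_ne_zero_of_mul_eq_one h5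

/-- In a local coordinate, `d(y p(x)) = (Q' p / 2 + Q p')(x) dx / y`. -/
theorem deriv_odd (hg : IsHolChart g) {z : ℂ} (hz : z ∈ g.target) (p : Polynomial ℂ) :
    deriv (fun z => (g.symm z).y * p.eval (g.symm z).x) z =
      deriv (fun z => (g.symm z).x) z / (g.symm z).y *
        (oddDeriv (∏ b ∈ B, (Polynomial.X - Polynomial.C b)) p).eval (g.symm z).x := by
  set Q : Polynomial ℂ := ∏ b ∈ B, (Polynomial.X - Polynomial.C b)
  have hX := (differentiableAt_x_symm hg hz).hasDerivAt
  have hY := (differentiableAt_y_symm hg hz).hasDerivAt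
  have hy : (g.symm z).y ≠ 0 := y_ne_zero _
  have hQ : ∀ q : DoubleCover B, q.y ^ 2 = Q.eval q.x := fun q => by
    rw [q.sq_eq, Polynomial.eval_prod]
    simp
  have h1 : 2 * (g.symm z).y * deriv (fun z => (g.symm z).y) z =
      Q.derivative.eval (g.symm z).x * deriv (fun z => (g.symm z).x) z := by
    have e1 := hY.fun_pow 2
    have e2 := (Q.hasDerivAt (g.symm z).x).comp z hX
    have e3 : (fun w => (g.symm w).y ^ 2) = (fun w => Q.eval w) ∘ fun w => (g.symm w).x :=
      funext fun w => hQ _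
    rw [e3] at e1
    have := e1.unique e2
    simpa using this
  have hp : HasDerivAt (fun z => p.eval (g.symm z).x)
      (p.derivative.eval (g.symm z).x * deriv (fun z => (g.symm z).x) z) z := by
    have h := (p.hasDerivAt (g.symm z).x).comp z hX
    exact h
  have h2 := hY.fun_mul hp
  rw [h2.deriv, oddDeriv_apply]
  simp only [Polynomial.eval_add, Polynomial.eval_mul, Polynomial.eval_C, ← hQ]
  field_simp
  linear_combination p.eval (g.symm z).x * h1

/-- A local equation for the preimage of a point of the base. -/
theorem isTheta_x_sub (hg : IsHolChart g) {q s : DoubleCover B} (hq : q ∈ g.source) (hs : s ∈ g.source)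
    (hs' : tau s ∈ g.source) :
    (fun z => (g.symm z).x - s.x) =Θ[𝓝 (g q)] fun z => (z - g s) * (z - g (tau s)) := by
  have hgq := g.map_source hq
  have hX := differentiableAt_x_symm hg hgq
  have hqX : (g.symm (g q)).x = q.x := by rw [g.left_inv hq]
  have hfac : ∀ t ∈ g.source, q ≠ t → (fun z => z - g t) =Θ[𝓝 (g q)] fun _ => (1 : ℂ) := by
    intro t ht hqt
    refine isTheta_one_of_ne (by fun_prop) ?_
    exact sub_ne_zero.2 fun h => hqt (g.injOn hq ht h)
  have hself : q.x = s.x → (fun z => (g.symm z).x - s.x) =Θ[𝓝 (g q)] fun z => z - g q := by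
    intro h
    have h1 := HasDerivAtFilter.isTheta_sub hX.hasDerivAt (deriv_x_symm_ne_zero hg hgq)
    have h2 : (fun z => (g.symm z).x - (g.symm (g q)).x) =Θ[𝓝 (g q)] fun z => z - g q :=
      have hk : Tendsto (fun z => (z, g q)) (𝓝 (g q)) (𝓝 (g q) ×ˢ pure (g q)) :=
        tendsto_id.prodMk (tendsto_pure.2 (Eventually.of_forall fun _ => rfl))
      ⟨h1.1.comp_tendsto hk, h1.2.comp_tendsto hk⟩
    rwa [hqX, h] at h2
  by_cases h : q.x = s.x
  · rcases eq_or_eq_tau h with rfl | rfl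
    · simpa using (hself h).mul (hfac _ hs' (ne_tau q)).symm
    · have h1 := (hfac _ hs (ne_tau s).symm).symm.mul (hself h)
      simpa using h1
  · have h1 : (fun z => (g.symm z).x - s.x) =Θ[𝓝 (g q)] fun _ => (1 : ℂ) :=
      isTheta_one_of_ne (hX.continuousAt.sub continuousAt_const)
        (by rw [hqX]; exact sub_ne_zero.2 h)
    have h2 := (hfac s hs fun e => h (congrArg DoubleCover.x e)).mul
      (hfac (tau s) hs' fun e => h (congrArg DoubleCover.x e :))
    simp only [mul_one] at h2
    exact h1.trans h2.symm

end Chart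

end BranchedCover

namespace BranchedCover

open Filter Asymptotics SymProd Bundle ComplexBundle

variable {B : Finset ℂ}

/-! ### The conormal bundle of the invariant divisors -/

theorem mem_symEmbedding {m : ℕ} {s : Sym (puncturedSphere B) m} {q : DoubleCover B} :
    q ∈ symEmbedding B m s ↔ ∃ p ∈ s, q = lift p ∨ q = tau (lift p) := by
  change q ∈ s.1.map lift + s.1.map (fun x => tau (lift x)) ↔ _
  rw [Multiset.mem_add, Multiset.mem_map, Multiset.mem_map]
  constructor
  · rintro (⟨p, hp, rfl⟩ | ⟨p, hp, rfl⟩)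
    · exact ⟨p, hp, Or.inl rfl⟩
    · exact ⟨p, hp, Or.inr rfl⟩
  · rintro ⟨p, hp, rfl | rfl⟩
    · exact Or.inl ⟨p, hp, rfl⟩
    · exact Or.inr ⟨p, hp, rfl⟩

theorem traceFun_symEmbedding {m : ℕ} (ψ : DoubleCover B → ℂ) (s : Sym (puncturedSphere B) m) :
    traceFun ψ (symEmbedding B m s) = traceFun (fun p => ψ (lift p) + ψ (tau (lift p))) s := by
  change ((s.1.map lift + s.1.map fun x => tau (lift x)).map ψ).sum = _
  rw [Multiset.map_add, Multiset.sum_add, Multiset.map_map, Multiset.map_map]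
  exact Multiset.sum_map_add.symm

theorem lift_x (p : puncturedSphere B) : (lift p).x = p :=
  congrArg Subtype.val (Function.surjInv_eq proj_surjective p)

theorem prod_of_ofTuple_eq_symEmbedding {m : ℕ} {x : Fin m → puncturedSphere B}
    {t : Fin (2 * m) → DoubleCover B} (ht : ofTuple t = symEmbedding B m (ofTuple x))
    (φ : DoubleCover B → ℂ) :
    ∏ j, φ (t j) = ∏ k, φ (lift (x k)) * φ (tau (lift (x k))) := by
  have h := congrArg (fun s : Sym (DoubleCover B) (2 * m) => (s.1.map φ).prod) ht
  change ((Finset.univ.val.map t).map φ).prod =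
    (((Finset.univ.val.map x).map lift +
      (Finset.univ.val.map x).map fun x => tau (lift x)).map φ).prod at h
  rw [Multiset.map_add, Multiset.prod_add] at h
  simp only [Multiset.map_map] at h
  rw [Finset.prod_mul_distrib]
  exact h

/-- The polynomial `∏ b ∈ B, (X - b)` whose square root is the coordinate `y`. -/
def branchPoly (B : Finset ℂ) : Polynomial ℂ := ∏ b ∈ B, (Polynomial.X - Polynomial.C b)

theorem eval_branchPoly_ne_zero (p : puncturedSphere B) : (branchPoly B).eval (p : ℂ) ≠ 0 := by
  have h := prod_ne_zero p.2
  rw [branchPoly, Polynomial.eval_prod]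
  simpa using h

theorem contMDiff_odd (p : Polynomial ℂ) :
    ContMDiff 𝓘(ℂ) 𝓘(ℂ) ω fun q : DoubleCover B => q.y * p.eval q.x :=
  contMDiff_y.mul (p.differentiable.contDiff.contMDiff.comp contMDiff_x)

/-- The differential of the trace of the odd function `y p(x)` at the invariant divisor lying over
`x₁ + ⋯ + x_m` vanishes if and only if `∏ k, (X - x k)` divides the coefficient of
`d(y p(x))`. -/
theorem mfderiv_traceFun_odd_eq_zero_iff {m : ℕ} (x : Fin m → puncturedSphere B)
    (p : Polynomial ℂ) :
    (∀ v, mfderiv 𝓘(ℂ, Fin (2 * m) → ℂ) 𝓘(ℂ) (traceFun fun q => q.y * p.eval q.x)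
      (symEmbedding B m (ofTuple x)) v = (0 : ℂ)) ↔
      monicPoly (esymmFun (ofTuple fun k => (x k : ℂ))) ∣ oddDeriv (branchPoly B) p := by
  obtain ⟨t, ht⟩ := ofTuple_surjective (symEmbedding B m (ofTuple x))
  obtain ⟨g, hg, hsg⟩ := exists_isHolChart_sym (symEmbedding B m (ofTuple x))
  set u := oddDeriv (branchPoly B) p with hu
  set P := monicPoly (esymmFun (ofTuple fun k => (x k : ℂ))) with hP
  have hmem : ∀ q ∈ symEmbedding B m (ofTuple x), q ∈ g.source := hsg
  have htm : ∀ j, t j ∈ symEmbedding B m (ofTuple x) := fun j => by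
    rw [← ht]
    exact mem_ofTuple.2 ⟨j, rfl⟩
  have hl : ∀ k, lift (x k) ∈ symEmbedding B m (ofTuple x) := fun k =>
    mem_symEmbedding.2 ⟨x k, mem_ofTuple.2 ⟨k, rfl⟩, Or.inl rfl⟩
  have hl' : ∀ k, tau (lift (x k)) ∈ symEmbedding B m (ofTuple x) := fun k =>
    mem_symEmbedding.2 ⟨x k, mem_ofTuple.2 ⟨k, rfl⟩, Or.inr rfl⟩
  -- in the local coordinate the divisor is cut out by the pullback of `P`
  have hΘ : ∀ q ∈ g.source, (fun z => P.eval (g.symm z).x) =Θ[𝓝 (g q)]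
      fun z => ∏ j, (z - g (t j)) := by
    intro q hq
    have h1 : ∀ z, ∏ j, (z - g (t j)) =
        ∏ k, (z - g (lift (x k))) * (z - g (tau (lift (x k)))) := fun z =>
      prod_of_ofTuple_eq_symEmbedding ht fun q => z - g q
    simp only [h1, hP, eval_monicPoly_esymmFun]
    have h2 := fun k => isTheta_x_sub hg hq (hmem _ (hl k)) (hmem _ (hl' k))
    simp only [lift_x] at h2
    exact ⟨IsBigO.finsetProd fun k _ => (h2 k).1, IsBigO.finsetProd fun k _ => (h2 k).2⟩
  have hder : ∀ q ∈ g.source, (deriv fun z => (g.symm z).y * p.eval (g.symm z).x) =ᶠ[𝓝 (g q)]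
      fun z => deriv (fun z => (g.symm z).x) z / (g.symm z).y * u.eval (g.symm z).x := by
    intro q hq
    filter_upwards [g.open_target.mem_nhds (g.map_source hq)] with z hz
    exact deriv_odd hg hz p
  have hunit : ∀ q ∈ g.source,
      (fun z => deriv (fun z => (g.symm z).x) z / (g.symm z).y) =Θ[𝓝 (g q)] fun _ => (1 : ℂ) := by
    intro q hq
    have hgq := g.map_source hq
    have h1 : DifferentiableOn ℂ (fun z => (g.symm z).x) g.target := fun z hz =>
      (differentiableAt_x_symm hg hz).differentiableWithinAt
    refine isTheta_one_of_ne (ContinuousAt.div ?_ ?_ (y_ne_zero _)) ?_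
    · exact ((h1.deriv g.open_target).differentiableAt (g.open_target.mem_nhds hgq)).continuousAt
    · exact (differentiableAt_y_symm hg hgq).continuousAt
    · exact div_ne_zero (deriv_x_symm_ne_zero hg hgq) (y_ne_zero _)
  have hΘ' : ∀ q ∈ g.source, (deriv fun z => (g.symm z).y * p.eval (g.symm z).x) =Θ[𝓝 (g q)]
      fun z => u.eval (g.symm z).x := by
    intro q hq
    refine (hder q hq).isTheta.trans ?_
    simpa using (hunit q hq).mul (isTheta_refl (fun z => u.eval (g.symm z).x) (𝓝 (g q)))
  rw [← ht, mfderiv_traceFun_eq_zero_iff hg (contMDiff_odd p) fun j => hmem _ (htm j)]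
  constructor
  · intro h
    rw [hP, monicPoly_esymmFun]
    refine prod_dvd_of_isBigO _ _ fun r hr => ?_
    rw [← monicPoly_esymmFun, ← hP]
    obtain ⟨k, rfl⟩ := mem_ofTuple.1 hr
    set q := lift (x k) with hq
    have hqs : q ∈ g.source := hmem _ (hl k)
    obtain ⟨j, hj⟩ := mem_ofTuple.1 (ht ▸ hl k)
    have h1 : (fun z => u.eval (g.symm z).x) =O[𝓝 (g q)] fun z => P.eval (g.symm z).x := by
      have h2 := h j
      rw [hj] at h2
      exact (hΘ' q hqs).2.trans (h2.trans (hΘ q hqs).2)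
    -- pull back along the local section of `x` through `q`
    have hqx : sheetChart q q = (x k : ℂ) := lift_x (x k)
    have hss := mem_source_sheetChart q
    have htgt : (sheetChart q).target ∈ 𝓝 (x k : ℂ) := by
      rw [← hqx]
      exact (sheetChart q).open_target.mem_nhds ((sheetChart q).map_source hss)
    have hsq : (sheetChart q).symm (x k : ℂ) = q := by
      rw [← hqx, (sheetChart q).left_inv hss]
    have hcont : ContinuousAt (sheetChart q).symm (x k : ℂ) :=
      (sheetChart q).continuousAt_symm (mem_of_mem_nhds htgt)
    have hcont' : Tendsto (sheetChart q).symm (𝓝 (x k : ℂ)) (𝓝 q) := by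
      rw [ContinuousAt, hsq] at hcont
      exact hcont
    have hT : Tendsto (fun w => g ((sheetChart q).symm w)) (𝓝 (x k : ℂ)) (𝓝 (g q)) :=
      (g.continuousAt hqs).tendsto.comp hcont'
    refine ((h1.comp_tendsto hT).congr' ?_ ?_).mono nhdsWithin_le_nhds
    all_goals
      filter_upwards [htgt, hcont'.eventually (g.open_source.mem_nhds hqs)] with w hw hwg
      simp only [Function.comp_apply]
      rw [g.left_inv hwg, sheetChart_symm_x q hw]
  · rintro ⟨v, hv⟩ j
    have hjs := hmem _ (htm j)
    refine (hΘ' _ hjs).1.trans (IsBigO.trans ?_ (hΘ _ hjs).1)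
    have hc : ContinuousAt (fun z => v.eval (g.symm z).x) (g (t j)) :=
      v.continuous.continuousAt.comp
        (differentiableAt_x_symm hg (g.map_source hjs)).continuousAt
    have h1 := (isBigO_refl (fun z => P.eval (g.symm z).x) (𝓝 (g (t j)))).mul (hc.isBigO_one ℂ)
    simpa only [hv, Polynomial.eval_mul, mul_one] using h1

/-- The traces of the odd functions `y x ^ i`. -/
def oddTrace (B : Finset ℂ) (m : ℕ) (s : Sym (DoubleCover B) (2 * m)) : Fin (2 * m) → ℂ :=
  fun i => traceFun (fun q => q.y * q.x ^ i.1) s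

theorem contMDiff_oddTrace (m : ℕ) :
    ContMDiff 𝓘(ℂ, Fin (2 * m) → ℂ) 𝓘(ℂ, Fin (2 * m) → ℂ) ω (oddTrace B m) := by
  refine contMDiff_pi_space.2 fun i s => contMDiffAt_traceFun isOpen_univ ?_ fun _ _ => trivial
  have h := contMDiff_odd (B := B) (Polynomial.X ^ i.1)
  simp only [Polynomial.eval_pow, Polynomial.eval_X] at h
  exact h.contMDiffOn

theorem oddTrace_symEmbedding {m : ℕ} (s : Sym (puncturedSphere B) m) :
    oddTrace B m (symEmbedding B m s) = 0 := by
  funext i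
  rw [oddTrace, traceFun_symEmbedding]
  simp [traceFun, tau]

/-- The kernel of `oddMatrix` consists of the linear relations between the differentials of the
components of `oddTrace`. -/
theorem oddMatrix_mulVec_eq_zero_iff_mfderiv {m : ℕ} (x : Fin m → puncturedSphere B)
    (b : Fin (2 * m) → ℂ) :
    (oddMatrix (branchPoly B) (esymmFun (ofTuple fun k => (x k : ℂ)))).mulVec b = 0 ↔
      ∀ v, mfderiv 𝓘(ℂ, Fin (2 * m) → ℂ) 𝓘(ℂ, Fin (2 * m) → ℂ) (oddTrace B m)
        (symEmbedding B m (ofTuple x)) v ⬝ᵥ b = 0 := by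
  rw [oddMatrix_mulVec_eq_zero_iff, ← mfderiv_traceFun_odd_eq_zero_iff]
  let ℓ : (Fin (2 * m) → ℂ) →L[ℂ] ℂ := ∑ i, b i • ContinuousLinearMap.proj i
  have hℓ : ∀ c, ℓ c = c ⬝ᵥ b := fun c => by simp [ℓ, dotProduct, mul_comm]
  have h1 : (traceFun fun q : DoubleCover B => q.y * (polyOfCoeffs b).eval q.x) =
      ℓ ∘ oddTrace B m := by
    funext s
    obtain ⟨t, rfl⟩ := ofTuple_surjective s
    simp only [Function.comp_apply, hℓ, dotProduct, oddTrace, traceFun_ofTuple, polyOfCoeffs,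
      Polynomial.eval_finsetSum, Polynomial.eval_smul, Polynomial.eval_pow, Polynomial.eval_X,
      smul_eq_mul, Finset.mul_sum, Finset.sum_mul]
    rw [Finset.sum_comm]
    exact Finset.sum_congr rfl fun i _ => Finset.sum_congr rfl fun j _ => by ring
  rw [h1, mfderiv_comp _ ℓ.differentiableAt.mdifferentiableAt
    ((contMDiff_oddTrace m).mdifferentiable (by simp) _)]
  refine forall_congr' fun v => ?_
  rw [mfderiv_eq_fderiv, ℓ.fderiv]
  exact iff_of_eq (congrArg (· = 0) (hℓ _))

end BranchedCover

namespace BranchedCover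

open Filter Asymptotics SymProd Bundle ComplexBundle

variable {B : Finset ℂ}

/-! ### The embedding of the symmetric product of the base -/

theorem contMDiff_tau : ContMDiff 𝓘(ℂ) 𝓘(ℂ) ω (tau : DoubleCover B → DoubleCover B) := by
  intro q
  have hq := mem_source_sheetChart q
  have h1 : ContMDiffAt 𝓘(ℂ) 𝓘(ℂ) ω ((sheetChart (tau q)).symm ∘ DoubleCover.x) q := by
    refine ContMDiffAt.comp (I' := 𝓘(ℂ)) q ?_ (contMDiff_x q)
    have h2 : q.x ∈ (sheetChart (tau q)).target :=
      (sheetChart (tau q)).map_source (x := tau q) (mem_source_sheetChart (tau q))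
    exact (isHolChart_sheetChart (tau q)).2.contMDiffAt
      ((sheetChart (tau q)).open_target.mem_nhds h2)
  refine h1.congr_of_eventuallyEq ?_
  filter_upwards [(sheetChart q).open_source.mem_nhds hq] with p hp
  refine ((sheetChart (tau q)).left_inv (x := tau p) ?_).symm
  change 0 < (-p.y / -q.y).re
  rw [neg_div_neg_eq]
  exact hp

/-- Over the target of a sheet, the fibre of the covering is given by the sheet and its image under
the involution. -/
theorem lift_eq_or (q₀ : DoubleCover B) {p : puncturedSphere B}
    (hp : (p : ℂ) ∈ (sheetChart q₀).target) :
    (lift p = (sheetChart q₀).symm p ∧ tau (lift p) = tau ((sheetChart q₀).symm p)) ∨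
      (lift p = tau ((sheetChart q₀).symm p) ∧ tau (lift p) = (sheetChart q₀).symm p) := by
  have h : (lift p).x = ((sheetChart q₀).symm p).x := by
    rw [lift_x, sheetChart_symm_x q₀ hp]
  rcases eq_or_eq_tau h with h1 | h1
  · exact Or.inl ⟨h1, congrArg tau h1⟩
  · exact Or.inr ⟨h1, by rw [h1, tau_tau]⟩

theorem contMDiffAt_sheetChart_symm_val (p : puncturedSphere B) :
    ContMDiffAt 𝓘(ℂ) 𝓘(ℂ) ω
      (fun r : puncturedSphere B => (sheetChart (lift p)).symm (r : ℂ)) p := by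
  have h1 : (p : ℂ) ∈ (sheetChart (lift p)).target := by
    have h2 := (sheetChart (lift p)).map_source (mem_source_sheetChart _)
    rwa [sheetChart_apply, lift_x] at h2
  have h3 : ContMDiffAt 𝓘(ℂ) 𝓘(ℂ) ω (sheetChart (lift p)).symm (p : ℂ) :=
    (isHolChart_sheetChart _).2.contMDiffAt ((sheetChart _).open_target.mem_nhds h1)
  exact ContMDiffAt.comp (I' := 𝓘(ℂ)) p h3 contMDiff_subtype_val.contMDiffAt

theorem sheetChart_symm_val (p : puncturedSphere B) :
    (sheetChart (lift p)).symm (p : ℂ) = lift p := by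
  have h := (sheetChart (lift p)).left_inv (mem_source_sheetChart _)
  rwa [sheetChart_apply, lift_x] at h

theorem eventually_mem_target (p : puncturedSphere B) :
    ∀ᶠ r : puncturedSphere B in 𝓝 p, (r : ℂ) ∈ (sheetChart (lift p)).target := by
  have h2 := (sheetChart (lift p)).map_source (mem_source_sheetChart _)
  rw [sheetChart_apply, lift_x] at h2
  exact continuous_subtype_val.continuousAt.eventually
    ((sheetChart (lift p)).open_target.mem_nhds h2)

theorem isOpen_setOf_lift_mem {U : Set (DoubleCover B)} (hU : IsOpen U) :
    IsOpen {p : puncturedSphere B | lift p ∈ U ∧ tau (lift p) ∈ U} := by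
  rw [isOpen_iff_mem_nhds]
  rintro p ⟨h1, h2⟩
  have hc := (contMDiffAt_sheetChart_symm_val p).continuousAt
  have hc' := (contMDiff_tau (B := B)).continuous.continuousAt.comp hc
  rw [← sheetChart_symm_val p] at h1 h2
  filter_upwards [eventually_mem_target p, hc.eventually (hU.mem_nhds h1),
    hc'.eventually (hU.mem_nhds h2)] with r hr hr1 hr2
  rcases lift_eq_or _ hr with ⟨e1, e2⟩ | ⟨e1, e2⟩
  · exact ⟨e1 ▸ hr1, e2 ▸ hr2⟩
  · exact ⟨e1 ▸ hr2, e2 ▸ hr1⟩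

/-- The direct image of a holomorphic function under the covering is holomorphic. -/
theorem contMDiffOn_add_tau {U : Set (DoubleCover B)} (hU : IsOpen U) {ψ : DoubleCover B → ℂ}
    (hψ : ContMDiffOn 𝓘(ℂ) 𝓘(ℂ) ω ψ U) :
    ContMDiffOn 𝓘(ℂ) 𝓘(ℂ) ω (fun p : puncturedSphere B => ψ (lift p) + ψ (tau (lift p)))
      {p | lift p ∈ U ∧ tau (lift p) ∈ U} := by
  rintro p ⟨h1, h2⟩
  refine ContMDiffAt.contMDiffWithinAt ?_
  have hc := contMDiffAt_sheetChart_symm_val p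
  rw [← sheetChart_symm_val p] at h1 h2
  have e1 := ContMDiffAt.comp p (hψ.contMDiffAt (hU.mem_nhds h1)) hc
  have e2 := ContMDiffAt.comp p (hψ.contMDiffAt (hU.mem_nhds h2))
    ((contMDiff_tau _).comp p hc)
  refine (e1.add e2).congr_of_eventuallyEq ?_
  filter_upwards [eventually_mem_target p] with r hr
  rcases lift_eq_or _ hr with ⟨e1, -⟩ | ⟨e1, -⟩
  · rw [e1]
    rfl
  · rw [e1, tau_tau, add_comm]
    rfl

/-- The embedding is holomorphic. -/
theorem mdifferentiableAt_symEmbedding {m : ℕ} (s : Sym (puncturedSphere B) m) :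
    MDifferentiableAt 𝓘(ℂ, Fin m → ℂ) 𝓘(ℂ, Fin (2 * m) → ℂ) (symEmbedding B m) s := by
  obtain ⟨g, hg, hsg⟩ := exists_isHolChart_sym (symEmbedding B m s)
  have hV := isOpen_setOf_lift_mem g.open_source
  have hsource : ∀ r : Sym (puncturedSphere B) m,
      symEmbedding B m r ∈ (symChart (2 * m) g).source ↔
        ∀ p ∈ r, p ∈ {p : puncturedSphere B | lift p ∈ g.source ∧ tau (lift p) ∈ g.source} := by
    intro r
    constructor
    · exact fun h p hp => ⟨h _ (mem_symEmbedding.2 ⟨p, hp, Or.inl rfl⟩),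
        h _ (mem_symEmbedding.2 ⟨p, hp, Or.inr rfl⟩)⟩
    · intro h q hq
      obtain ⟨p, hp, rfl | rfl⟩ := mem_symEmbedding.1 hq
      · exact (h p hp).1
      · exact (h p hp).2
  have hs := (hsource s).1 hsg
  refine mdifferentiableAt_of_traceFun hg ?_ fun k => ?_
  · filter_upwards [(isOpen_setOf_forall_mem hV).mem_nhds hs] with r hr
    exact (hsource r).2 hr
  · simp only [traceFun_symEmbedding]
    exact contMDiffAt_traceFun hV (contMDiffOn_add_tau g.open_source (hg.1.pow (k.1 + 1))) hs

/-- Half the traces of the powers of the coordinate `x`; on `x̃₁ τ(x̃₁) ⋯ x̃_m τ(x̃_m)` these are the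
power sums of `x₁, …, x_m`. -/
def evenTrace (B : Finset ℂ) (m : ℕ) (s : Sym (DoubleCover B) (2 * m)) : Fin m → ℂ :=
  fun k => 2⁻¹ * traceFun (fun q => q.x ^ (k.1 + 1)) s

theorem contMDiff_evenTrace (m : ℕ) :
    ContMDiff 𝓘(ℂ, Fin (2 * m) → ℂ) 𝓘(ℂ, Fin m → ℂ) ω (evenTrace B m) :=
  contMDiff_pi_space.2 fun k _ => contMDiffAt_const.mul
    (contMDiffAt_traceFun isOpen_univ (contMDiff_x.pow (k.1 + 1)).contMDiffOn fun _ _ => trivial)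

theorem evenTrace_symEmbedding {m : ℕ} (s : Sym (puncturedSphere B) m) (k : Fin m) :
    evenTrace B m (symEmbedding B m s) k =
      traceFun (fun p : puncturedSphere B => (p : ℂ) ^ (k.1 + 1)) s := by
  obtain ⟨x, rfl⟩ := ofTuple_surjective s
  have h : ∀ p : puncturedSphere B, (tau (lift p)).x = p := lift_x
  rw [evenTrace, traceFun_symEmbedding, traceFun_ofTuple, traceFun_ofTuple, Finset.mul_sum]
  refine Finset.sum_congr rfl fun j _ => ?_
  rw [lift_x, h]
  ring

/-- The embedding is an immersion. -/
theorem mfderiv_symEmbedding_injective {m : ℕ} (s : Sym (puncturedSphere B) m) :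
    Function.Injective
      (mfderiv 𝓘(ℂ, Fin m → ℂ) 𝓘(ℂ, Fin (2 * m) → ℂ) (symEmbedding B m) s) := by
  let p₀ : puncturedSphere B := Classical.arbitrary _
  let g := chartAt ℂ p₀
  have hgs : ∀ p, p ∈ g.source := fun p => by
    simp [g, TopologicalSpace.Opens.chartAt_eq, chartAt_self_eq]
  have hg : ∀ p, g p = p := fun p => rfl
  have hgh : IsHolChart g := isHolChart_chartAt p₀
  rw [injective_iff_map_eq_zero]
  intro v hv
  refine eq_zero_of_mfderiv_traceFun_pow hgh (s := s) (fun p _ => hgs p) v ?_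
  have h1 : (fun s (k : Fin m) => traceFun (fun p : puncturedSphere B => g p ^ (k.1 + 1)) s) =
      evenTrace B m ∘ symEmbedding B m := by
    funext s k
    exact (evenTrace_symEmbedding s k).symm
  rw [h1, mfderiv_comp s ((contMDiff_evenTrace m).mdifferentiable (by simp) _)
    (mdifferentiableAt_symEmbedding s)]
  change mfderiv 𝓘(ℂ, Fin (2 * m) → ℂ) 𝓘(ℂ, Fin m → ℂ) (evenTrace B m) (symEmbedding B m s)
    (mfderiv 𝓘(ℂ, Fin m → ℂ) 𝓘(ℂ, Fin (2 * m) → ℂ) (symEmbedding B m) s v) = 0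
  rw [hv]
  exact map_zero _

/-- The elementary symmetric functions of `x₁, …, x_m` depend continuously on the divisor
`x̃₁ τ(x̃₁) ⋯ x̃_m τ(x̃_m)`. -/
theorem exists_continuous_esymmFun (B : Finset ℂ) (m : ℕ) :
    ∃ a : Sym (DoubleCover B) (2 * m) → (Fin m → ℂ), Continuous a ∧
      ∀ x : Fin m → puncturedSphere B,
        a (symEmbedding B m (ofTuple x)) = esymmFun (ofTuple fun k => (x k : ℂ)) := by
  obtain ⟨T, hT, hTs⟩ := exists_esymmFun_eq m
  refine ⟨T ∘ evenTrace B m, hT.continuous.comp (contMDiff_evenTrace m).continuous, fun x => ?_⟩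
  rw [Function.comp_apply, hTs]
  congr 1
  funext k
  rw [evenTrace_symEmbedding, traceFun_ofTuple, psumFun, sum_map_ofTuple]

end BranchedCover

namespace BranchedCover

open Filter SymProd Bundle ComplexBundle

variable {B : Finset ℂ}

/-! ### Triviality of the normal bundle -/

theorem ker_eq_of_finrank {U V W : Type*} [AddCommGroup U] [Module ℂ U] [AddCommGroup V]
    [Module ℂ V] [AddCommGroup W] [Module ℂ W] [FiniteDimensional ℂ V]
    {φ : U →ₗ[ℂ] V} {θ : V →ₗ[ℂ] W} {K : Submodule ℂ V} (hφ : Function.Injective φ)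
    (hθ : Function.Surjective θ) (h₁ : LinearMap.range φ ≤ K) (h₂ : K ≤ LinearMap.ker θ)
    (hd : Module.finrank ℂ V = Module.finrank ℂ W + Module.finrank ℂ U) :
    LinearMap.ker θ = K := by
  have h := θ.finrank_range_add_finrank_ker
  rw [LinearMap.range_eq_top.2 hθ, finrank_top, hd, Nat.add_left_cancel_iff] at h
  have h' := Submodule.eq_of_le_of_finrank_eq (h₁.trans h₂)
    ((LinearMap.finrank_range_of_inj hφ).trans h.symm)
  exact le_antisymm (h'.ge.trans h₁) h₂

/-- A surjection from the tangent space of `Sym^{2m}` onto `ℂ^m` which vanishes on the kernel of the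
differential of `oddTrace` has the tangent space of the image of the embedding as its kernel: this
tangent space lies in the kernel, and has the same dimension `m`. -/
theorem imageTangentSpace_symEmbedding {m : ℕ} (x : Fin m → puncturedSphere B)
    (θ : TangentSpace 𝓘(ℂ, Fin (2 * m) → ℂ) (symEmbedding B m (ofTuple x)) →ₗ[ℂ] (Fin m → ℂ))
    (hsurj : Function.Surjective θ)
    (hker : ∀ v, mfderiv 𝓘(ℂ, Fin (2 * m) → ℂ) 𝓘(ℂ, Fin (2 * m) → ℂ) (oddTrace B m)
      (symEmbedding B m (ofTuple x)) v = (0 : Fin (2 * m) → ℂ) → θ v = 0) :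
    LinearMap.ker θ = imageTangentSpace 𝓘(ℂ, Fin m → ℂ) 𝓘(ℂ, Fin (2 * m) → ℂ)
      (symEmbedding B m) (symEmbedding B m (ofTuple x)) := by
  have : FiniteDimensional ℂ (TangentSpace 𝓘(ℂ, Fin (2 * m) → ℂ)
      (symEmbedding B m (ofTuple x))) := inferInstanceAs (FiniteDimensional ℂ (Fin (2 * m) → ℂ))
  refine ker_eq_of_finrank (φ := (mfderiv 𝓘(ℂ, Fin m → ℂ) 𝓘(ℂ, Fin (2 * m) → ℂ)
    (symEmbedding B m) (ofTuple x)).toLinearMap) (mfderiv_symEmbedding_injective (ofTuple x))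
    hsurj ?_ ?_ ?_
  · rintro _ ⟨u, rfl⟩
    exact Submodule.subset_span ⟨⟨ofTuple x, u⟩, rfl⟩
  · refine Submodule.span_le.2 ?_
    rintro v ⟨⟨s, u⟩, hw⟩
    refine hker v ?_
    -- the differential of `oddTrace ∘ symEmbedding = 0` vanishes
    have h1 : oddTrace B m ∘ symEmbedding B m = fun _ => 0 := funext oddTrace_symEmbedding
    have h2 := mfderiv_comp_apply s ((contMDiff_oddTrace m).mdifferentiable (by simp) _)
      (mdifferentiableAt_symEmbedding (B := B) s) u
    rw [h1, mfderiv_const] at h2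
    have h3 : ∀ w : TangentBundle 𝓘(ℂ, Fin (2 * m) → ℂ) (Sym (DoubleCover B) (2 * m)),
        tangentMap 𝓘(ℂ, Fin m → ℂ) 𝓘(ℂ, Fin (2 * m) → ℂ) (symEmbedding B m) ⟨s, u⟩ = w →
        mfderiv 𝓘(ℂ, Fin (2 * m) → ℂ) 𝓘(ℂ, Fin (2 * m) → ℂ) (oddTrace B m) w.1 w.2 =
          (0 : Fin (2 * m) → ℂ) := by
      rintro w rfl
      exact h2.symm
    exact h3 _ hw
  · change Module.finrank ℂ (Fin (2 * m) → ℂ) =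
      Module.finrank ℂ (Fin m → ℂ) + Module.finrank ℂ (Fin m → ℂ)
    simp only [Module.finrank_fin_fun]
    omega

theorem isTrivial_normalBundle_symEmbedding (B : Finset ℂ) (m : ℕ) :
    IsTrivial (Fin m → ℂ) (NormalBundle 𝓘(ℂ, Fin m → ℂ) 𝓘(ℂ, Fin (2 * m) → ℂ)
      (symEmbedding B m)) := by
  obtain ⟨a, ha, hax⟩ := exists_continuous_esymmFun B m
  let S := Set.range (symEmbedding B m)
  have hS : ∀ p : S, ∃ x : Fin m → puncturedSphere B,
      (p : Sym (DoubleCover B) (2 * m)) = symEmbedding B m (ofTuple x) := by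
    rintro ⟨_, s, rfl⟩
    obtain ⟨x, rfl⟩ := ofTuple_surjective s
    exact ⟨x, rfl⟩
  let A : S → Matrix (Fin m) (Fin (2 * m)) ℂ := fun p => oddMatrix (branchPoly B) (a p)
  have hA : Continuous A :=
    (continuous_oddMatrix (branchPoly B)).comp (ha.comp continuous_subtype_val)
  have hAs : ∀ p, Function.Surjective (A p).mulVec := by
    intro p
    obtain ⟨x, hx⟩ := hS p
    simp only [A, hx, hax]
    exact oddMatrix_surjective _ _ fun k => eval_branchPoly_ne_zero (x k)
  obtain ⟨R, hR, hAR⟩ := exists_continuous_rightInverse hA hAs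
  let dE : ∀ p : S, TangentSpace 𝓘(ℂ, Fin (2 * m) → ℂ) (p : Sym (DoubleCover B) (2 * m)) →ₗ[ℂ]
      (Fin (2 * m) → ℂ) := fun p =>
    (mfderiv 𝓘(ℂ, Fin (2 * m) → ℂ) 𝓘(ℂ, Fin (2 * m) → ℂ) (oddTrace B m)
      (p : Sym (DoubleCover B) (2 * m))).toLinearMap
  have hker : ∀ (p : S) (b : Fin (2 * m) → ℂ),
      (A p).mulVec b = 0 ↔ ∀ v, dE p v ⬝ᵥ b = 0 := by
    rintro ⟨_, s, rfl⟩ b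
    obtain ⟨x, rfl⟩ := ofTuple_surjective s
    simp only [A, hax]
    exact oddMatrix_mulVec_eq_zero_iff_mfderiv x b
  let θ : ∀ p : S, TangentSpace 𝓘(ℂ, Fin (2 * m) → ℂ) (p : Sym (DoubleCover B) (2 * m)) →ₗ[ℂ]
      (Fin m → ℂ) := fun p => (R p).vecMulLinear ∘ₗ dE p
  have hθ : ∀ p v, θ p v = Matrix.vecMul (dE p v) (R p) := fun p v => rfl
  have hsurj : ∀ p, Function.Surjective (θ p) := by
    intro p
    rw [← LinearMap.range_eq_top]
    by_contra hne
    obtain ⟨ℓ, hℓ0, hℓ⟩ := Submodule.exists_le_ker_of_lt_top _ (lt_top_iff_ne_top.2 hne)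
    let c : Fin m → ℂ := fun j => ℓ (Pi.single j 1)
    have hc : ∀ w, ℓ w = w ⬝ᵥ c := fun w => by
      conv_lhs => rw [LinearMap.pi_apply_eq_sum_univ ℓ w]
      simp only [dotProduct, c, smul_eq_mul]
      refine Finset.sum_congr rfl fun j _ => ?_
      congr 2
      ext i
      simp [Pi.single_apply, eq_comm]
    have h1 : (A p).mulVec ((R p).mulVec c) = 0 := by
      refine (hker p _).2 fun v => ?_
      rw [Matrix.dotProduct_mulVec, ← hθ, ← hc]
      exact hℓ ⟨v, rfl⟩
    rw [Matrix.mulVec_mulVec, hAR, Matrix.one_mulVec] at h1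
    refine hℓ0 (LinearMap.ext fun w => ?_)
    rw [hc, h1, dotProduct_zero]
    rfl
  refine isTrivial_normalBundle _ θ ?_ hsurj ?_
  · have h1 : Continuous fun v : TangentBundle 𝓘(ℂ, Fin (2 * m) → ℂ)
        (Sym (DoubleCover B) (2 * m)) =>
        (tangentMap 𝓘(ℂ, Fin (2 * m) → ℂ) 𝓘(ℂ, Fin (2 * m) → ℂ) (oddTrace B m) v).2 := by
      have h2 := (contMDiff_oddTrace (B := B) m).continuous_tangentMap (by simp)
      exact continuous_snd.comp
        ((tangentBundleModelSpaceHomeomorph 𝓘(ℂ, Fin (2 * m) → ℂ)).continuous.comp h2)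
    have h3 : Continuous fun v : {v : TangentBundle 𝓘(ℂ, Fin (2 * m) → ℂ)
        (Sym (DoubleCover B) (2 * m)) // v.proj ∈ S} => R ⟨v.1.proj, v.2⟩ :=
      hR.comp (((FiberBundle.continuous_proj _ _).comp continuous_subtype_val).subtype_mk _)
    exact (h1.comp continuous_subtype_val).matrix_vecMul h3
  · rintro ⟨_, s, rfl⟩
    obtain ⟨x, rfl⟩ := ofTuple_surjective s
    refine imageTangentSpace_symEmbedding x (θ _) (hsurj _) fun v hv => ?_
    rw [hθ]
    exact (congrArg (fun w => Matrix.vecMul w _) hv).trans (Matrix.zero_vecMul _)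

end BranchedCover

end

theorem lemma7 (n : ℕ) (B : Finset ℂ) (hB : B.card + 1 = 2 * n) :
    ComplexBundle.IsTrivial (Fin (n - 1) → ℂ) (BranchedCover.normalMinv B n) ∧
      ComplexBundle.IsTrivial (Fin (n - 1) → ℂ) (BranchedCover.upsilonMinv B n) := by
  have h := BranchedCover.isTrivial_normalBundle_symEmbedding B (n - 1)
  exact ⟨h, h.pullback ContinuousMap.fst⟩
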